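/- Let $\mu=(\mu(a))_{a\ge 0}$ be non-negative numbers with $\sum_a\mu(a)<\infty$ and $\mu(1)>0$. Let $(c_t(a,m))$, $t\ge 0$, $a\in\{0,1,\dots\}$, $m\in\{1,2,\dots\}$, be the solution with initial condition $c_0(a,m)=\mu(a)\mathbf 1_{\{m=1\}}$ of Smoluchowski's equation with arms, that is, a family of non-negative numbers such that, with $\langle c,f\rangle=\sum_{a\ge0,\,m\ge1}f(a)c(a,m)$ and $A_t=\langle c_t,a\rangle\in[0,\infty]$: * $\int_0^tA_s^2\,ds<\infty$ for every $t>0$; * for all $t>0$, $a\ge 0$, $m\ge 1$, $$c_t(a,m)=c_0(a,m)+\int_0^t\Big[\tfrac12\sum_{a'=1}^{a+1}\sum_{m'=1}^{m-1}a'(a+2-a')\,c_s(a',m')\,c_s(a+2-a',m-m')-\sum_{a',m'\ge1}aa'\,c_s(a,m)\,c_s(a',m')\Big]ds;$$ * if $\langle c_0,a^2\rangle<\infty$, then $t\mapsto\langle c_t,a^2\rangle$ is bounded in a right neighbourhood of $0$. Put $\alpha_t=\exp\big(\int_0^tA_s\,ds\big)$, $\beta_t=\int_0^t\alpha_s^{-2}\,ds$,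 $\nu(j)=(j+1)\mu(j+1)$ for $j\ge0$, let $\nu^{*m}$ be the $m$-fold convolution power of $\nu$, $k_0(x)=\sum_{a\ge1}a\mu(a)x^{a-1}$ for $x\in[0,1]$, $A_0=\sum_a a\mu(a)\in(0,\infty]$ and $K=\sum_a a(a-1)\mu(a)\in[0,\infty]$. The gelation time is $T_{\rm gel}=1/(K-A_0)$ if $A_0<K<\infty$, $T_{\rm gel}=0$ if $K=\infty$, and $T_{\rm gel}=\infty$ if $K\le A_0<\infty$; there is gelation if $T_{\rm gel}<\infty$. Then: 1. For all $t\ge0$, $m\ge2$, $a\ge0$, $$c_t(a,m)=\frac{(a+m-2)!}{a!\,m!}\,\frac{\beta_t^{m-1}}{\alpha_t^{a}}\,\nu^{*m}(a+m-2).$$ 2. As $t\to\infty$, $c_t(a,m)\to0$ for all $a\ge1$, $m\ge1$; moreover $\beta_t$ converges to a limit $\beta_\infty\in(0,\infty)$, and for all $m\ge2$ $$c_t(0,m)\to\frac1{m(m-1)}\,\beta_\infty^{m-1}\,\nu^{*m}(m-2).$$ 3. If $K\ge A_0$ (in particular, if there is gelation), there is a unique $c\in(0,1]$ at which $k_0$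 is differentiable on $[0,1]$ (from the left if $c=1$) and $k_0'(c)=k_0(c)/c$, and $$\beta_\infty=\frac1{k_0'(c)}=\frac{c}{k_0(c)}.$$ 4. If there is no gelation, $\beta_\infty=1/A_0$; if there is gelation, $\beta_\infty>1/A_0$ (with $1/\infty=0$). Under the normalisation $A_0=1$ this reads $\beta_\infty=1$ without gelation and $\beta_\infty>1$ with gelation. -/

import Mathlib

open Filter Topology MeasureTheory Set
open scoped NNReal ENNReal Nat

noncomputable section

namespace ArmsModel

/- Concentrations are functions `c : ℕ → ℕ → ℝ`, where `c a m` is the concentration of particles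
with `a ≥ 0` arms and mass `m ≥ 1`.  The value of `c` at `m = 0` has no meaning and is never used:
sums over masses `m ≥ 1` are written as sums over `n : ℕ` with `m = n + 1`. -/

/-- `⟨c, f⟩ = ∑_{a ≥ 0} ∑_{m ≥ 1} f a * c a m`, as an element of `[0, ∞]`. -/
def moment (c : ℕ → ℕ → ℝ) (f : ℕ → ℝ) : ℝ≥0∞ :=
  ∑' p : ℕ × ℕ, ENNReal.ofReal (f p.1 * c p.1 (p.2 + 1))

/-- The number of arms `A = ⟨c, a⟩`. -/
def arms (c : ℕ → ℕ → ℝ) : ℝ≥0∞ := moment c (fun a => (a : ℝ))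

/-- `K = ⟨c, a (a - 1)⟩`. -/
def armsFactorialMoment (c : ℕ → ℕ → ℝ) : ℝ≥0∞ :=
  moment c (fun a => (a : ℝ) * ((a : ℝ) - 1))

/-- The gain term: a pair of particles with `a', a + 2 - a' ≥ 1` arms and masses
`m', m - m' ≥ 1` produces a particle with `a` arms and mass `m`. -/
def gain (c : ℕ → ℕ → ℝ) (a m : ℕ) : ℝ :=
  (1 / 2) * ∑ a' ∈ Finset.Icc 1 (a + 1), ∑ m' ∈ Finset.Icc 1 (m - 1),
    (a' : ℝ) * ((a + 2 - a' : ℕ) : ℝ) * c a' m' * c (a + 2 - a') (m - m')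

/-- The loss term `∑_{a' ≥ 1} ∑_{m' ≥ 1} a a' c(a, m) c(a', m')` (the terms with `a' = 0`
vanish). -/
def loss (c : ℕ → ℕ → ℝ) (a m : ℕ) : ℝ :=
  ∑' p : ℕ × ℕ, (a : ℝ) * (p.1 : ℝ) * c a m * c p.1 (p.2 + 1)

/-- Global solutions of Smoluchowski's equation with arms, with initial concentrations `c 0`. -/
structure IsSolution (c : ℝ → ℕ → ℕ → ℝ) : Prop where
  nonneg : ∀ t, 0 ≤ t → ∀ a m, 1 ≤ m → 0 ≤ c t a m
  arms_sq : ∀ t, 0 < t → ∫⁻ s in Ioc 0 t, arms (c s) ^ 2 < ∞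
  gain_integrable : ∀ t, 0 < t → ∀ a m, 1 ≤ m →
    IntervalIntegrable (fun s => gain (c s) a m) volume 0 t
  loss_integrable : ∀ t, 0 < t → ∀ a m, 1 ≤ m →
    IntervalIntegrable (fun s => loss (c s) a m) volume 0 t
  equation : ∀ t, 0 < t → ∀ a m, 1 ≤ m →
    c t a m = c 0 a m + (∫ s in (0 : ℝ)..t, gain (c s) a m) - ∫ s in (0 : ℝ)..t, loss (c s) a m
  second_moment : moment (c 0) (fun a => (a : ℝ) ^ 2) < ∞ →
    ∃ ε : ℝ, 0 < ε ∧ ∃ C : ℝ≥0, ∀ t ∈ Ioo 0 ε, moment (c t) (fun a => (a : ℝ) ^ 2) ≤ C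

/-- `α_t = exp (∫_0^t A_s ds)`. -/
def alpha (c : ℝ → ℕ → ℕ → ℝ) (t : ℝ) : ℝ :=
  Real.exp (∫ s in (0 : ℝ)..t, (arms (c s)).toReal)

/-- `β_t = ∫_0^t α_s⁻² ds`. -/
def beta (c : ℝ → ℕ → ℕ → ℝ) (t : ℝ) : ℝ :=
  ∫ s in (0 : ℝ)..t, 1 / alpha c s ^ 2

open Classical in
/-- The gelation time for the initial concentrations `c`: `1 / (K - A)` if `A < K < ∞`, `0` if
`K = ∞`, and `∞` if `K ≤ A < ∞`. -/
def gelTime (c : ℕ → ℕ → ℝ) : ℝ≥0∞ :=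
  if armsFactorialMoment c = ∞ then 0
  else if arms c < armsFactorialMoment c then (armsFactorialMoment c - arms c)⁻¹
  else ∞

/-- The generating function
`k(x, y) = ∑_{a ≥ 1} ∑_{m ≥ 1} a c(a, m) x ^ (a - 1) y ^ m`. -/
def armsGen (c : ℕ → ℕ → ℝ) (x y : ℝ) : ℝ :=
  ∑' p : ℕ × ℕ, ((p.1 : ℝ) + 1) * c (p.1 + 1) (p.2 + 1) * x ^ p.1 * y ^ (p.2 + 1)

/-- `r ∈ (0, 1]` is a tangency point of `k`: the function `k` on `[0, 1]` is differentiable at `r`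
(from the left if `r = 1`) and `k'(r) = k(r) / r`. -/
def IsTangencyPoint (k : ℝ → ℝ) (r : ℝ) : Prop :=
  r ∈ Ioc (0 : ℝ) 1 ∧ DifferentiableWithinAt ℝ k (Icc 0 1) r ∧
    derivWithin k (Icc 0 1) r = k r / r

/-- The `m`-fold convolution power `ν^{*m}` of a sequence `ν` on `ℕ`. -/
def convPow (ν : ℕ → ℝ) : ℕ → ℕ → ℝ
  | 0, n => if n = 0 then 1 else 0
  | m + 1, n => ∑ p ∈ Finset.HasAntidiagonal.antidiagonal n, ν p.1 * convPow ν m p.2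

/-- `ν(j) = (j + 1) μ(j + 1)`. -/
def shifted (μ : ℕ → ℝ) (j : ℕ) : ℝ := ((j : ℝ) + 1) * μ (j + 1)

end ArmsModel

end

open ArmsModel

/-! Write `k` for the generating function of `ν`, and put `z = 1/α`. The factor `α ^ a` absorbs the
loss term, so `c_t(a,m) α_t ^ a` has derivative `gain * α_t ^ a`. The gain is a convolution, and `dβ
= α⁻² dt`. Hence `(b+1) c_t(b+1,n+1) α_t ^ (b+1)` is `β_t ^ n` times the coefficient of `z ^ b β ^
n` in the formal solution `F(z,β)` of Burgers' equation `∂_β F = F ∂_z F`, `F(z,0) = k(z)`. Lagrange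
inversion computes the coefficients of the powers of `F` (`coeff_burgers_pow`), and induction on the
mass gives the explicit formula (`IsSolution.explicit`).

All coefficients are nonnegative, so `F` can be evaluated in `[0,∞]` without any convergence
question. There `F = k(z + βF)` (`burgersSum_eq_genSeries`), and `z + βF` is the least `x` with `z +
βk(x) ≤ x` (`burgersSum_le_genSeries`). Summing the explicit concentrations gives `αA = F(z,β)`, and
therefore `dz/dβ = -F(z,β)` along the solution.

The long-time limit follows by two barrier arguments. If `z + βk(x) < x`, then `F ≤ k(x)` and `z +
βk(x)` cannot decrease; hence `x ≤ z + βk(x)` at all times. If no `x ≤ 1` satisfies `z + βk(x) ≤ x`,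
then `F ≥ k(1)`; this forces such an `x` to exist at all times when `k(1) < ∞`, and whenever `A_t <
∞` with `t > 0` when `k(1) = ∞`. Since `μ(1) > 0`, `β` is bounded and `z → 0`, and the two bounds
give `β∞ = sup x / k(x)` over `x ∈ (0,1]` with `k(x) < ∞` (`IsSolution.limit_beta`).

What remains is convex analysis: a tangent to `k` through the origin touches at a minimiser of
`k(x)/x`. The minimiser is unique by strict convexity. It is `1` without gelation and lies strictly
inside `(0,1)` with gelation. -/

namespace ArmsModel

/-! ### Formal Burgers equation and Lagrange inversion -/

open PowerSeries

/-- Coefficientwise differentiation of a power series with power series coefficients. -/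
noncomputable def coeffDeriv (A : PowerSeries (PowerSeries ℝ≥0)) : PowerSeries (PowerSeries ℝ≥0) :=
  PowerSeries.mk fun n => d⁄dX ℝ≥0 (coeff n A)

theorem coeffDeriv_mul (A B : PowerSeries (PowerSeries ℝ≥0)) :
    coeffDeriv (A * B) = A * coeffDeriv B + coeffDeriv A * B := by
  ext1 n
  simp only [coeffDeriv, coeff_mk, coeff_mul, map_sum, map_add, Derivation.leibniz, smul_eq_mul,
    ← Finset.sum_add_distrib]
  exact Finset.sum_congr rfl fun p _ => by ring

theorem coeffDeriv_one : coeffDeriv 1 = 0 := by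
  ext1 n
  simp only [coeffDeriv, coeff_mk, coeff_one]
  split_ifs <;> simp

theorem coeffDeriv_add (A B : PowerSeries (PowerSeries ℝ≥0)) :
    coeffDeriv (A + B) = coeffDeriv A + coeffDeriv B := by
  ext1 n
  simp [coeffDeriv]

theorem coeffDeriv_pow (A : PowerSeries (PowerSeries ℝ≥0)) (p : ℕ) :
    coeffDeriv (A ^ (p + 1)) = (p + 1 : ℕ) * A ^ p * coeffDeriv A := by
  induction p with
  | zero => simp
  | succ p ih =>
    rw [pow_succ, coeffDeriv_mul, ih]
    push_cast
    ring

/-- Coefficients of the power series solution of Burgers' equation `∂F = F F'`, `F 0 = k`. -/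
noncomputable def burgersCoeff (k : PowerSeries ℝ≥0) : ℕ → PowerSeries ℝ≥0
  | 0 => k
  | n + 1 => ((n : ℝ≥0) + 1)⁻¹ • ∑ i : Fin (n + 1),
      burgersCoeff k i * d⁄dX ℝ≥0 (burgersCoeff k (n - i))
termination_by n => n
decreasing_by all_goals omega

/-- The power series solution of Burgers' equation `∂F = F F'` with initial value `k`. -/
noncomputable def burgers (k : PowerSeries ℝ≥0) : PowerSeries (PowerSeries ℝ≥0) :=
  PowerSeries.mk (burgersCoeff k)

theorem coeff_zero_burgers (k : PowerSeries ℝ≥0) : coeff 0 (burgers k) = k := by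
  rw [burgers, coeff_mk, burgersCoeff]

theorem derivative_burgers (k : PowerSeries ℝ≥0) :
    d⁄dX (PowerSeries ℝ≥0) (burgers k) = burgers k * coeffDeriv (burgers k) := by
  ext1 n
  rw [coeff_derivative, coeff_mul, burgers, coeff_mk, burgersCoeff,
    Finset.Nat.sum_antidiagonal_eq_sum_range_succ_mk, ← Fin.sum_univ_eq_sum_range
      (fun i => coeff i (mk (burgersCoeff k)) * coeff (n - i) (coeffDeriv (mk (burgersCoeff k))))]
  simp only [coeffDeriv, coeff_mk]
  have h : ((n : PowerSeries ℝ≥0) + 1) = PowerSeries.C ((n : ℝ≥0) + 1) := by simp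
  rw [h, mul_comm, ← smul_eq_C_mul, smul_smul, mul_inv_cancel₀ (by positivity), one_smul]

/-- Burgers' equation gives `(p+2) ∂(F^(p+1)) = (p+1) (F^(p+2))'`. Each order in `β` therefore costs
one derivative and raises the power by one, so the induction on `n` must keep `p` general. -/
theorem coeff_burgers_pow (k : PowerSeries ℝ≥0) (n p : ℕ) :
    coeff n (burgers k ^ (p + 1)) =
      (((p : ℝ≥0) + 1) / (((p : ℝ≥0) + 1 + n) * n !)) • (d⁄dX ℝ≥0)^[n] (k ^ (n + p + 1)) := by
  induction n generalizing p with
  | zero =>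
    have : ((p : ℝ≥0) + 1) / (((p : ℝ≥0) + 1 + (0 : ℕ)) * (0 ! : ℕ)) = 1 := by
      simp only [Nat.cast_zero, add_zero, Nat.factorial_zero, Nat.cast_one, mul_one]
      exact div_self (by positivity)
    rw [this, one_smul, coeff_zero_eq_constantCoeff_apply, map_pow,
      ← coeff_zero_eq_constantCoeff_apply, coeff_zero_burgers]
    simp
  | succ n ih =>
    have h1 : d⁄dX (PowerSeries ℝ≥0) (burgers k ^ (p + 1)) * ((p + 2 : ℕ) : PowerSeries (PowerSeries ℝ≥0))
        = ((p + 1 : ℕ) : PowerSeries (PowerSeries ℝ≥0)) * coeffDeriv (burgers k ^ (p + 1 + 1)) := by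
      rw [derivative_pow, derivative_burgers, coeffDeriv_pow]
      push_cast
      ring
    have h2 := congrArg (coeff n) h1
    have e : ∀ m : ℕ, (m : PowerSeries (PowerSeries ℝ≥0)) = PowerSeries.C (PowerSeries.C (m : ℝ≥0)) := by
      intro m; simp
    rw [e, e, coeff_mul_C, coeff_C_mul, coeff_derivative, coeffDeriv, coeff_mk, ih, Derivation.map_smul,
      ← Function.iterate_succ_apply' (⇑(d⁄dX ℝ≥0)), ← smul_eq_C_mul, smul_smul] at h2
    have h3 : ((n : PowerSeries ℝ≥0) + 1) = PowerSeries.C ((n : ℝ≥0) + 1) := by simp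
    rw [h3, mul_assoc, ← map_mul, mul_comm, ← smul_eq_C_mul] at h2
    have h4 := congrArg (fun u => ((((n : ℝ≥0) + 1) * ((p + 2 : ℕ) : ℝ≥0))⁻¹) • u) h2
    simp only [smul_smul] at h4
    rw [inv_mul_cancel₀ (by positivity), one_smul] at h4
    rw [h4, show n + 1 + p + 1 = n + (p + 1) + 1 by ring]
    congr 1
    rw [Nat.factorial_succ]
    push_cast
    have : (n ! : ℝ≥0) ≠ 0 := by positivity
    have : (p : ℝ≥0) + 1 + 1 + n ≠ 0 := by positivity
    have : (p : ℝ≥0) + 2 ≠ 0 := by positivity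
    have : (n : ℝ≥0) + 1 ≠ 0 := by positivity
    have : (p : ℝ≥0) + 1 + (n + 1) ≠ 0 := by positivity
    field_simp
    ring

theorem coeff_mk_pow (ν : ℕ → ℝ≥0) (m n : ℕ) :
    ((coeff n (PowerSeries.mk ν ^ m) : ℝ≥0) : ℝ) = convPow (fun j => (ν j : ℝ)) m n := by
  induction m generalizing n with
  | zero => 
    rw [pow_zero, coeff_one, convPow]
    split_ifs <;> simp
  | succ m ih =>
    rw [pow_succ', coeff_mul, convPow]
    push_cast
    exact Finset.sum_congr rfl fun p _ => by rw [ih, coeff_mk]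

/-- Coefficient of `z ^ i β ^ n` in the `(p + 1)`-st power of the Burgers series. -/
theorem coeff_coeff_burgers_pow (ν : ℕ → ℝ≥0) (n p i : ℕ) :
    ((coeff i (coeff n (burgers (PowerSeries.mk ν) ^ (p + 1))) : ℝ≥0) : ℝ) =
      ((p : ℝ) + 1) / (((p : ℝ) + 1 + n) * n !) * ((i + n)! / i !) *
        convPow (fun j => (ν j : ℝ)) (n + p + 1) (i + n) := by
  rw [coeff_burgers_pow, coeff_smul, smul_eq_mul, coeff_iterate_derivative]
  push_cast
  rw [coeff_mk_pow, ← mul_assoc]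
  congr 2
  rw [eq_div_iff (by positivity), ← Nat.cast_mul, mul_comm, Nat.factorial_mul_ascFactorial]

end ArmsModel

/-! ### The implicit equation `F = k(z + βF)` and minimality of its solution -/

namespace ArmsModel

open PowerSeries

/-- The characteristic `z + β F(z, β)` of the Burgers series. -/
noncomputable def characteristic (k : PowerSeries ℝ≥0) : PowerSeries (PowerSeries ℝ≥0) :=
  PowerSeries.C PowerSeries.X + PowerSeries.X * burgers k

theorem coeffDeriv_characteristic (k : PowerSeries ℝ≥0) :
    coeffDeriv (characteristic k) = 1 + PowerSeries.X * coeffDeriv (burgers k) := by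
  have h1 : coeffDeriv (PowerSeries.C (PowerSeries.X : PowerSeries ℝ≥0)) = 1 := by
    ext1 n
    simp only [coeffDeriv, coeff_mk, coeff_C, coeff_one]
    split_ifs <;> simp
  have h2 : coeffDeriv (PowerSeries.X) = 0 := by
    ext1 n
    simp only [coeffDeriv, coeff_mk, coeff_X, map_zero]
    split_ifs <;> simp
  rw [characteristic, coeffDeriv_add, h1, coeffDeriv_mul, h2, zero_mul, add_zero]

theorem derivative_characteristic (k : PowerSeries ℝ≥0) :
    d⁄dX (PowerSeries ℝ≥0) (characteristic k) = burgers k * coeffDeriv (characteristic k) := by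
  have h : d⁄dX (PowerSeries ℝ≥0) (PowerSeries.C (PowerSeries.X : PowerSeries ℝ≥0)) = 0 := by
    ext1 n
    rw [coeff_derivative, coeff_C, if_neg n.succ_ne_zero, zero_mul, map_zero]
  have h' : d⁄dX (PowerSeries ℝ≥0) (PowerSeries.X * burgers k) =
      burgers k + PowerSeries.X * d⁄dX (PowerSeries ℝ≥0) (burgers k) := by
    ext1 n
    rw [coeff_derivative, coeff_succ_X_mul, map_add]
    cases n with
    | zero => simp
    | succ n =>
      rw [coeff_succ_X_mul, coeff_derivative]
      push_cast
      ring
  rw [coeffDeriv_characteristic, characteristic, map_add, h, h', derivative_burgers]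
  ring

theorem derivative_characteristic_pow (k : PowerSeries ℝ≥0) (j : ℕ) :
    d⁄dX (PowerSeries ℝ≥0) (characteristic k ^ j) =
      burgers k * coeffDeriv (characteristic k ^ j) := by
  cases j with
  | zero => simp [coeffDeriv_one]
  | succ j =>
    rw [derivative_pow, derivative_characteristic, coeffDeriv_pow]
    simp only [add_tsub_cancel_right]
    ring

theorem coeff_coeff_succ_of_derivative_eq {k : PowerSeries ℝ≥0}
    {A : PowerSeries (PowerSeries ℝ≥0)}
    (hA : d⁄dX (PowerSeries ℝ≥0) A = burgers k * coeffDeriv A) (n i : ℕ) :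
    ((coeff i (coeff (n + 1) A) : ℝ≥0) : ℝ≥0∞) * ((n : ℝ≥0∞) + 1) =
      ∑ p ∈ Finset.HasAntidiagonal.antidiagonal n, ∑ q ∈ Finset.HasAntidiagonal.antidiagonal i,
        ((coeff q.1 (coeff p.1 (burgers k)) : ℝ≥0) : ℝ≥0∞) *
          (((coeff (q.2 + 1) (coeff p.2 A) : ℝ≥0) : ℝ≥0∞) * ((q.2 : ℝ≥0∞) + 1)) := by
  have h : coeff i (coeff n (d⁄dX (PowerSeries ℝ≥0) A)) =
      coeff i (coeff n (burgers k * coeffDeriv A)) := by rw [hA]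
  have h3 : ((n : PowerSeries ℝ≥0) + 1) = PowerSeries.C ((n : ℝ≥0) + 1) := by simp
  rw [coeff_derivative, h3, coeff_mul_C] at h
  have h4 := congrArg (fun u : ℝ≥0 => (u : ℝ≥0∞)) h
  simp only [coeff_mul, coeff_derivative, coeffDeriv, coeff_mk, map_sum] at h4
  push_cast at h4
  exact h4

/-- This is `k(h) = F` for the characteristic `h`, coefficient by coefficient. Both sides solve the
linear transport equation `∂G = F G'` with `G = k` at `β = 0`, and that equation determines order `n
+ 1` from the lower orders. Sums are taken in `[0,∞]` so that they may be interchanged freely. -/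
theorem tsum_coeff_coeff_characteristic_pow (ν : ℕ → ℝ≥0) (n i : ℕ) :
    ∑' j, (ν j : ℝ≥0∞) * ((coeff i (coeff n (characteristic (PowerSeries.mk ν) ^ j)) : ℝ≥0) : ℝ≥0∞)
      = ((coeff i (coeff n (burgers (PowerSeries.mk ν))) : ℝ≥0) : ℝ≥0∞) := by
  induction n using Nat.strong_induction_on generalizing i with
  | _ n ih =>
  cases n with
  | zero =>
    have : ∀ j, coeff i (coeff 0 (characteristic (PowerSeries.mk ν) ^ j)) = if i = j then 1 else 0 := by
      intro j
      rw [coeff_zero_eq_constantCoeff_apply, map_pow, characteristic, map_add, map_mul,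
        constantCoeff_X, constantCoeff_C, zero_mul, add_zero, coeff_X_pow]
    simp only [this]
    rw [tsum_eq_single i (fun j hj => by rw [if_neg hj.symm]; simp), coeff_zero_burgers, coeff_mk]
    simp
  | succ n =>
    have hne : ((n : ℝ≥0∞) + 1) ≠ 0 := by simp
    have hnt : ((n : ℝ≥0∞) + 1) ≠ ∞ := by simp
    rw [← ENNReal.mul_left_inj hne hnt, ← ENNReal.tsum_mul_right,
      coeff_coeff_succ_of_derivative_eq (derivative_burgers _)]
    simp_rw [mul_assoc,
      coeff_coeff_succ_of_derivative_eq (derivative_characteristic_pow (PowerSeries.mk ν) _),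
      Finset.mul_sum]
    rw [Summable.tsum_finsetSum (fun _ _ => ENNReal.summable)]
    refine Finset.sum_congr rfl fun p hp => ?_
    rw [Summable.tsum_finsetSum (fun _ _ => ENNReal.summable)]
    refine Finset.sum_congr rfl fun q _ => ?_
    rw [← ih p.2 (by have := Finset.HasAntidiagonal.mem_antidiagonal.1 hp; omega), ← ENNReal.tsum_mul_right,
      ← ENNReal.tsum_mul_left]
    exact tsum_congr fun j => by ring

theorem _root_.ENNReal.tsum_mul_tsum_eq_tsum_sum_antidiagonal (f g : ℕ → ℝ≥0∞) :
    (∑' n, f n) * ∑' n, g n =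
      ∑' n, ∑ p ∈ Finset.HasAntidiagonal.antidiagonal n, f p.1 * g p.2 := by
  simp_rw [← ENNReal.tsum_mul_right, ← ENNReal.tsum_mul_left]
  rw [← ENNReal.tsum_prod, ← (Finset.HasAntidiagonal.sigmaAntidiagonalEquivProd (A := ℕ)).tsum_eq,
    ENNReal.tsum_sigma']
  refine tsum_congr fun n => ?_
  rw [tsum_fintype]
  exact Finset.sum_coe_sort _ (fun p : ℕ × ℕ => f p.1 * g p.2)

/-- Evaluation of a power series at `b ∈ [0, ∞]`, coefficients being mapped to `[0, ∞]`. -/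
noncomputable def evalENNReal {R : Type*} [CommSemiring R] (ψ : R →+* ℝ≥0∞) (b : ℝ≥0∞) :
    PowerSeries R →+* ℝ≥0∞ where
  toFun A := ∑' n, ψ (coeff n A) * b ^ n
  map_one' := by
    rw [tsum_eq_single 0 (fun n hn => by rw [coeff_one, if_neg hn]; simp)]
    simp
  map_zero' := by simp
  map_add' A B := by simp [add_mul, ENNReal.tsum_add]
  map_mul' A B := by
    rw [ENNReal.tsum_mul_tsum_eq_tsum_sum_antidiagonal]
    refine tsum_congr fun n => ?_
    rw [coeff_mul, map_sum, Finset.sum_mul]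
    refine Finset.sum_congr rfl fun p hp => ?_
    rw [← Finset.HasAntidiagonal.mem_antidiagonal.1 hp, pow_add, map_mul]
    ring

theorem evalENNReal_apply {R : Type*} [CommSemiring R] (ψ : R →+* ℝ≥0∞) (b : ℝ≥0∞)
    (A : PowerSeries R) : evalENNReal ψ b A = ∑' n, ψ (coeff n A) * b ^ n := rfl

theorem evalENNReal_C {R : Type*} [CommSemiring R] (ψ : R →+* ℝ≥0∞) (b : ℝ≥0∞) (r : R) :
    evalENNReal ψ b (PowerSeries.C r) = ψ r := by
  rw [evalENNReal_apply, tsum_eq_single 0 (fun n hn => by rw [coeff_C, if_neg hn]; simp)]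
  simp

theorem evalENNReal_X {R : Type*} [CommSemiring R] (ψ : R →+* ℝ≥0∞) (b : ℝ≥0∞) :
    evalENNReal ψ b PowerSeries.X = b := by
  rw [evalENNReal_apply, tsum_eq_single 1 (fun n hn => by rw [coeff_X, if_neg hn]; simp)]
  simp

/-- The power series `∑ ν j x ^ j` with values in `[0, ∞]`. -/
noncomputable def genSeries (ν : ℕ → ℝ≥0) (x : ℝ≥0∞) : ℝ≥0∞ := ∑' j, (ν j : ℝ≥0∞) * x ^ j

theorem genSeries_mono (ν : ℕ → ℝ≥0) : Monotone (genSeries ν) := fun x y h =>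
  ENNReal.tsum_le_tsum fun j => by gcongr

/-- Evaluation of the inner variable. -/
noncomputable def evalInner (z : ℝ≥0∞) : PowerSeries ℝ≥0 →+* ℝ≥0∞ :=
  evalENNReal ENNReal.ofNNRealHom z

/-- The value of the Burgers series at `(z, b)`. -/
noncomputable def burgersSum (ν : ℕ → ℝ≥0) (z b : ℝ≥0∞) : ℝ≥0∞ :=
  evalENNReal (evalInner z) b (burgers (PowerSeries.mk ν))

theorem evalInner_coeff_burgers (ν : ℕ → ℝ≥0) (z : ℝ≥0∞) (n : ℕ) :
    evalInner z (coeff n (burgers (PowerSeries.mk ν))) =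
      ∑' j, (ν j : ℝ≥0∞) * evalInner z (coeff n (characteristic (PowerSeries.mk ν) ^ j)) := by
  simp_rw [evalInner, evalENNReal_apply, ← ENNReal.tsum_mul_left]
  rw [ENNReal.tsum_comm]
  refine tsum_congr fun i => ?_
  change ((coeff i (coeff n (burgers (PowerSeries.mk ν))) : ℝ≥0) : ℝ≥0∞) * z ^ i =
    ∑' j, (ν j : ℝ≥0∞) *
      (((coeff i (coeff n (characteristic (PowerSeries.mk ν) ^ j)) : ℝ≥0) : ℝ≥0∞) * z ^ i)
  rw [← tsum_coeff_coeff_characteristic_pow, ← ENNReal.tsum_mul_right]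
  exact tsum_congr fun j => by ring

theorem burgersSum_eq_genSeries (ν : ℕ → ℝ≥0) (z b : ℝ≥0∞) :
    burgersSum ν z b = genSeries ν (z + b * burgersSum ν z b) := by
  have h : z + b * burgersSum ν z b =
      evalENNReal (evalInner z) b (characteristic (PowerSeries.mk ν)) := by
    rw [characteristic, map_add, map_mul, evalENNReal_C, evalENNReal_X, evalInner, evalENNReal_X]
    rfl
  rw [h, genSeries]
  simp_rw [← map_pow]
  rw [burgersSum]
  simp_rw [evalENNReal_apply, ← ENNReal.tsum_mul_left]
  rw [ENNReal.tsum_comm]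
  refine tsum_congr fun n => ?_
  rw [evalInner_coeff_burgers, ← ENNReal.tsum_mul_right]
  exact tsum_congr fun j => by ring

/-- Partial sums of the Burgers series. -/
noncomputable def burgersPartialSum (ν : ℕ → ℝ≥0) (z b : ℝ≥0∞) (N : ℕ) : ℝ≥0∞ :=
  ∑ n ∈ Finset.range N, evalInner z (coeff n (burgers (PowerSeries.mk ν))) * b ^ n

theorem evalENNReal_trunc {R : Type*} [CommSemiring R] (ψ : R →+* ℝ≥0∞) (b : ℝ≥0∞)
    (A : PowerSeries R) (N : ℕ) :
    evalENNReal ψ b (trunc N A : PowerSeries R) =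
      ∑ n ∈ Finset.range N, ψ (coeff n A) * b ^ n := by
  rw [evalENNReal_apply, tsum_eq_sum (s := Finset.range N)]
  · refine Finset.sum_congr rfl fun n hn => ?_
    rw [Polynomial.coeff_coe, coeff_trunc, if_pos (Finset.mem_range.1 hn)]
  · intro n hn
    rw [Polynomial.coeff_coe, coeff_trunc, if_neg (by simpa using hn)]
    simp

/-- Up to order `N` in `β`, the powers of `h = z + βF` depend only on `h` truncated to those orders,
whose value is `z + b F_N`. The discarded higher terms are nonnegative. -/
theorem burgersPartialSum_succ_le (ν : ℕ → ℝ≥0) (z b : ℝ≥0∞) (N : ℕ) :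
    burgersPartialSum ν z b (N + 1) ≤ genSeries ν (z + b * burgersPartialSum ν z b N) := by
  set h := characteristic (PowerSeries.mk ν) with hh
  have h1 : z + b * burgersPartialSum ν z b N =
      evalENNReal (evalInner z) b (trunc (N + 1) h : PowerSeries (PowerSeries ℝ≥0)) := by
    rw [evalENNReal_trunc, Finset.sum_range_succ', add_comm, burgersPartialSum, Finset.mul_sum]
    congr 1
    · refine Finset.sum_congr rfl fun n _ => ?_
      have : coeff (n + 1) h = coeff n (burgers (PowerSeries.mk ν)) := by
        rw [hh, characteristic, map_add, coeff_succ_X_mul, coeff_C, if_neg (by omega), zero_add]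
      rw [this, pow_succ]
      ring
    · have : coeff 0 h = PowerSeries.X := by
        rw [hh, characteristic, coeff_zero_eq_constantCoeff_apply]
        simp
      rw [this, evalInner, evalENNReal_X, pow_zero, mul_one]
  rw [h1, genSeries, burgersPartialSum]
  simp_rw [evalInner_coeff_burgers, ← ENNReal.tsum_mul_right]
  rw [← Summable.tsum_finsetSum (fun _ _ => ENNReal.summable)]
  refine ENNReal.tsum_le_tsum fun j => ?_
  simp_rw [mul_assoc, ← Finset.mul_sum]
  gcongr
  rw [← map_pow, ← evalENNReal_trunc, ← trunc_trunc_pow, evalENNReal_trunc, evalENNReal_apply]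
  exact ENNReal.sum_le_tsum _

/-- Picard-type induction: each partial sum stays below the supersolution `k(x)`. -/
theorem burgersSum_le_genSeries {ν : ℕ → ℝ≥0} {z b x : ℝ≥0∞} (h : z + b * genSeries ν x ≤ x) :
    burgersSum ν z b ≤ genSeries ν x := by
  have key : ∀ N, burgersPartialSum ν z b N ≤ genSeries ν x := by
    intro N
    induction N with
    | zero => simp [burgersPartialSum]
    | succ N ih =>
      refine (burgersPartialSum_succ_le ν z b N).trans (genSeries_mono ν (le_trans ?_ h))
      gcongr
  rw [burgersSum, evalENNReal_apply, ENNReal.tsum_eq_iSup_nat]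
  exact iSup_le key

/-- The point `z + bF` is itself a supersolution, with equality, so it must exceed `1`. -/
theorem genSeries_one_le_burgersSum {ν : ℕ → ℝ≥0} {z b : ℝ≥0∞}
    (h : ∀ x ≤ 1, ¬ z + b * genSeries ν x ≤ x) : genSeries ν 1 ≤ burgersSum ν z b := by
  rw [burgersSum_eq_genSeries]
  refine genSeries_mono ν ?_
  by_contra hlt
  exact h _ (not_le.1 hlt).le (by rw [← burgersSum_eq_genSeries])

end ArmsModel

/-! ### Calculus of absolutely continuous functions -/

theorem AbsolutelyContinuousOnInterval.contDiff_comp {ψ f : ℝ → ℝ} {a b : ℝ}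
    (hψ : ContDiff ℝ 1 ψ) (hf : AbsolutelyContinuousOnInterval f a b) :
    AbsolutelyContinuousOnInterval (fun x => ψ (f x)) a b := by
  obtain ⟨C, hC⟩ := hf.exists_bound
  obtain ⟨K, hK⟩ := (hψ.contDiffOn (s := Icc (-C) C)).exists_lipschitzOnWith (by decide)
    (convex_Icc _ _) isCompact_Icc
  have hmem : ∀ x ∈ uIcc a b, f x ∈ Icc (-C) C := fun x hx => abs_le.1 (hC x hx)
  have h0 : Tendsto (fun E : ℕ × (ℕ → ℝ × ℝ) =>
      (K : ℝ) * ∑ i ∈ Finset.range E.1, dist (f (E.2 i).1) (f (E.2 i).2))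
      (AbsolutelyContinuousOnInterval.totalLengthFilter ⊓
        𝓟 (AbsolutelyContinuousOnInterval.disjWithin a b)) (𝓝 0) := by
    simpa using Tendsto.const_mul (K : ℝ) hf
  refine squeeze_zero' (Eventually.of_forall fun E => Finset.sum_nonneg fun _ _ => dist_nonneg)
    ?_ h0
  filter_upwards [mem_inf_of_right (mem_principal_self _)] with E hE
  rw [Finset.mul_sum]
  exact Finset.sum_le_sum fun i hi =>
    hK.dist_le_mul _ (hmem _ (hE.1 i hi).1) _ (hmem _ (hE.1 i hi).2)

namespace ArmsModel

/-- On `[0, T]`, `f` is absolutely continuous with derivative `f'` almost everywhere. -/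
structure HasPrimitive (f f' : ℝ → ℝ) (T : ℝ) : Prop where
  ac : AbsolutelyContinuousOnInterval f 0 T
  deriv : ∀ᵐ x, x ∈ uIcc 0 T → HasDerivAt f (f' x) x

namespace HasPrimitive

variable {f f' g g' : ℝ → ℝ} {T : ℝ}

theorem const (a T : ℝ) : HasPrimitive (fun _ => a) (fun _ => 0) T where
  ac := ContDiffOn.absolutelyContinuousOnInterval contDiffOn_const
  deriv := Eventually.of_forall fun _ _ => hasDerivAt_const _ a

theorem integral {f : ℝ → ℝ} {T : ℝ} (hf : IntervalIntegrable f volume 0 T) :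
    HasPrimitive (fun t => ∫ s in (0 : ℝ)..t, f s) f T where
  ac := hf.absolutelyContinuousOnInterval_intervalIntegral left_mem_uIcc
  deriv := hf.ae_hasDerivAt_integral.mono fun _ hx hxT => hx hxT 0 left_mem_uIcc

theorem add (hf : HasPrimitive f f' T) (hg : HasPrimitive g g' T) :
    HasPrimitive (fun x => f x + g x) (fun x => f' x + g' x) T where
  ac := hf.ac.fun_add hg.ac
  deriv := by
    filter_upwards [hf.deriv, hg.deriv] with x h1 h2 hx using (h1 hx).add (h2 hx)

theorem sub (hf : HasPrimitive f f' T) (hg : HasPrimitive g g' T) :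
    HasPrimitive (fun x => f x - g x) (fun x => f' x - g' x) T where
  ac := hf.ac.fun_sub hg.ac
  deriv := by
    filter_upwards [hf.deriv, hg.deriv] with x h1 h2 hx using (h1 hx).sub (h2 hx)

theorem mul (hf : HasPrimitive f f' T) (hg : HasPrimitive g g' T) :
    HasPrimitive (fun x => f x * g x) (fun x => f' x * g x + f x * g' x) T where
  ac := hf.ac.fun_mul hg.ac
  deriv := by
    filter_upwards [hf.deriv, hg.deriv] with x h1 h2 hx using (h1 hx).mul (h2 hx)

theorem comp {ψ ψ' : ℝ → ℝ} (hψ : ContDiff ℝ 1 ψ) (hψ' : ∀ x, HasDerivAt ψ (ψ' x) x)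
    (hf : HasPrimitive f f' T) : HasPrimitive (fun x => ψ (f x)) (fun x => ψ' (f x) * f' x) T where
  ac := hf.ac.contDiff_comp hψ
  deriv := hf.deriv.mono fun x h hx => (hψ' (f x)).comp x (h hx)

theorem continuousOn (hf : HasPrimitive f f' T) (hT : 0 ≤ T) : ContinuousOn f (Icc 0 T) := by
  simpa [uIcc_of_le hT] using hf.ac.continuousOn

theorem integral_eq_sub (hf : HasPrimitive f f' T) {s t : ℝ} (hs : 0 ≤ s) (hst : s ≤ t)
    (htT : t ≤ T) : ∫ x in s..t, f' x = f t - f s := by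
  have hsub : uIcc s t ⊆ uIcc 0 T := by
    rw [uIcc_of_le hst, uIcc_of_le (by linarith)]
    exact Icc_subset_Icc hs htT
  rw [← (hf.ac.mono hsub).integral_deriv_eq_sub]
  refine intervalIntegral.integral_congr_ae ?_
  filter_upwards [hf.deriv] with x hx hxm
  exact (hx (hsub (uIoc_subset_uIcc hxm))).deriv.symm

theorem intervalIntegrable (hf : HasPrimitive f f' T) :
    IntervalIntegrable f' volume 0 T := by
  refine hf.ac.intervalIntegrable_deriv.congr_ae ?_
  rw [EventuallyEq, ae_restrict_iff' measurableSet_uIoc]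
  filter_upwards [hf.deriv] with x hx hxm
  exact (hx (uIoc_subset_uIcc hxm)).deriv

end HasPrimitive

/-! ### Regularity of solutions and the integrating factor -/

section Solution

variable {c : ℝ → ℕ → ℕ → ℝ}

/-- Stated for the integral expression and not for `c` itself, because nothing is known about `c` at
negative times. -/
theorem IsSolution.hasPrimitive (hc : IsSolution c) {T : ℝ} (hT : 0 < T) {a m : ℕ} (hm : 1 ≤ m) :
    HasPrimitive (fun t => c 0 a m + (∫ s in (0 : ℝ)..t, gain (c s) a m) -
      ∫ s in (0 : ℝ)..t, loss (c s) a m) (fun s => gain (c s) a m - loss (c s) a m) T := by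
  have h := ((HasPrimitive.const (c 0 a m) T).add
    (HasPrimitive.integral (hc.gain_integrable T hT a m hm))).sub
    (HasPrimitive.integral (hc.loss_integrable T hT a m hm))
  simpa only [zero_add] using h

theorem IsSolution.eq (hc : IsSolution c) {t : ℝ} (ht : 0 ≤ t) {a m : ℕ} (hm : 1 ≤ m) :
    c t a m = c 0 a m + (∫ s in (0 : ℝ)..t, gain (c s) a m) -
      ∫ s in (0 : ℝ)..t, loss (c s) a m := by
  rcases ht.eq_or_lt with rfl | ht
  · simp
  · exact hc.equation t ht a m hm

theorem IsSolution.continuousOn (hc : IsSolution c) (T : ℝ) {a m : ℕ} (hm : 1 ≤ m) :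
    ContinuousOn (fun t => c t a m) (Icc 0 T) := by
  rcases lt_or_ge 0 T with hT | hT
  · exact ((hc.hasPrimitive hT hm).continuousOn hT.le).congr fun t ht => hc.eq ht.1 hm
  · exact (subsingleton_Icc_of_ge hT).continuousOn _

theorem IsSolution.aemeasurable_arms (hc : IsSolution c) (T : ℝ) :
    AEMeasurable (fun s => arms (c s)) (volume.restrict (Ioc 0 T)) := by
  unfold arms moment
  refine AEMeasurable.tsum fun p => ENNReal.measurable_ofReal.comp_aemeasurable ?_
  refine AEMeasurable.const_mul ?_ _
  exact ((hc.continuousOn T (by omega)).mono Ioc_subset_Icc_self).aemeasurable measurableSet_Ioc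

theorem IsSolution.lintegral_arms_lt_top (hc : IsSolution c) {T : ℝ} (hT : 0 < T) :
    ∫⁻ s in Ioc 0 T, arms (c s) < ∞ := by
  have h : ∀ x : ℝ≥0∞, x ≤ 1 + x ^ 2 := fun x => by
    rcases le_total x 1 with h | h
    · exact h.trans le_self_add
    · exact (le_self_pow h two_ne_zero).trans le_add_self
  calc ∫⁻ s in Ioc 0 T, arms (c s) ≤ ∫⁻ s in Ioc 0 T, (1 + arms (c s) ^ 2) :=
        lintegral_mono fun s => h _
    _ = volume (Ioc 0 T) + ∫⁻ s in Ioc 0 T, arms (c s) ^ 2 := by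
        rw [lintegral_add_left measurable_const]
        simp
    _ < ∞ := ENNReal.add_lt_top.2 ⟨by simp, hc.arms_sq T hT⟩

theorem IsSolution.intervalIntegrable_arms (hc : IsSolution c) {T : ℝ} (hT : 0 < T) :
    IntervalIntegrable (fun s => (arms (c s)).toReal) volume 0 T := by
  rw [intervalIntegrable_iff_integrableOn_Ioc_of_le hT.le]
  exact integrable_toReal_of_lintegral_ne_top (hc.aemeasurable_arms T)
    (hc.lintegral_arms_lt_top hT).ne

theorem IsSolution.ae_arms_lt_top (hc : IsSolution c) {T : ℝ} (hT : 0 < T) :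
    ∀ᵐ s, s ∈ Ioc 0 T → arms (c s) < ∞ := by
  rw [← ae_restrict_iff' measurableSet_Ioc]
  exact ae_lt_top' (hc.aemeasurable_arms T) (hc.lintegral_arms_lt_top hT).ne

theorem IsSolution.loss_eq (hc : IsSolution c) {t : ℝ} (ht : 0 ≤ t) (a m : ℕ) :
    loss (c t) a m = a * (arms (c t)).toReal * c t a m := by
  rw [loss, arms, moment, ENNReal.tsum_toReal_eq (fun _ => ENNReal.ofReal_ne_top),
    mul_right_comm, ← tsum_mul_left]
  refine tsum_congr fun p => ?_
  rw [ENNReal.toReal_ofReal (mul_nonneg (Nat.cast_nonneg _) (hc.nonneg t ht _ _ (by omega)))]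
  ring

/-- The logarithm of `alpha`. -/
noncomputable def logAlpha (c : ℝ → ℕ → ℕ → ℝ) (t : ℝ) : ℝ := ∫ s in (0 : ℝ)..t, (arms (c s)).toReal

theorem alpha_eq (c : ℝ → ℕ → ℕ → ℝ) (t : ℝ) : alpha c t = Real.exp (logAlpha c t) := rfl

theorem alpha_pos (c : ℝ → ℕ → ℕ → ℝ) (t : ℝ) : 0 < alpha c t := Real.exp_pos _

theorem alpha_zero (c : ℝ → ℕ → ℕ → ℝ) : alpha c 0 = 1 := by simp [alpha]

theorem beta_zero (c : ℝ → ℕ → ℕ → ℝ) : beta c 0 = 0 := by simp [beta]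

theorem IsSolution.hasPrimitive_exp (hc : IsSolution c) {T : ℝ} (hT : 0 < T) (r : ℝ) :
    HasPrimitive (fun t => Real.exp (r * logAlpha c t))
      (fun t => Real.exp (r * logAlpha c t) * r * (arms (c t)).toReal) T := by
  refine HasPrimitive.comp (ψ := fun x => Real.exp (r * x)) (ψ' := fun x => Real.exp (r * x) * r)
    (by fun_prop) (fun x => ?_) (HasPrimitive.integral (hc.intervalIntegrable_arms hT))
  simpa using ((hasDerivAt_id x).const_mul r).exp

theorem IsSolution.hasPrimitive_alpha_pow (hc : IsSolution c) {T : ℝ} (hT : 0 < T) (a : ℕ) :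
    HasPrimitive (fun t => alpha c t ^ a)
      (fun t => alpha c t ^ a * a * (arms (c t)).toReal) T := by
  simpa only [alpha_eq, ← Real.exp_nat_mul] using hc.hasPrimitive_exp hT a

/-- The derivative is kept as `-(αA) * β'`: in the clock `β`, the function `1/α` falls at speed
`αA`. -/
theorem IsSolution.hasPrimitive_inv_alpha (hc : IsSolution c) {T : ℝ} (hT : 0 < T) :
    HasPrimitive (fun t => (alpha c t)⁻¹)
      (fun t => -((alpha c t * (arms (c t)).toReal) * (1 / alpha c t ^ 2))) T := by
  have h := hc.hasPrimitive_exp hT (-1)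
  simp only [neg_one_mul, Real.exp_neg, ← alpha_eq] at h
  convert h using 2 with t
  have := (alpha_pos c t).ne'
  field_simp

theorem IsSolution.continuousOn_alpha (hc : IsSolution c) {T : ℝ} (hT : 0 < T) :
    ContinuousOn (alpha c) (Icc 0 T) := by
  simpa using (hc.hasPrimitive_alpha_pow hT 1).continuousOn hT.le

theorem IsSolution.intervalIntegrable_alpha (hc : IsSolution c) {T : ℝ} (hT : 0 < T) :
    IntervalIntegrable (fun t => 1 / alpha c t ^ 2) volume 0 T := by
  refine ContinuousOn.intervalIntegrable_of_Icc hT.le ?_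
  exact continuousOn_const.div ((hc.continuousOn_alpha hT).pow 2)
    fun t _ => (pow_pos (alpha_pos c t) 2).ne'

theorem IsSolution.hasPrimitive_beta (hc : IsSolution c) {T : ℝ} (hT : 0 < T) :
    HasPrimitive (beta c) (fun t => 1 / alpha c t ^ 2) T :=
  HasPrimitive.integral (hc.intervalIntegrable_alpha hT)

theorem IsSolution.integral_beta_pow (hc : IsSolution c) {t : ℝ} (ht : 0 < t) (n : ℕ) :
    ∫ s in (0 : ℝ)..t, beta c s ^ n * (1 / alpha c s ^ 2) = beta c t ^ (n + 1) / (n + 1) := by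
  have h := HasPrimitive.comp (ψ := fun x => x ^ (n + 1) / (n + 1)) (ψ' := fun x => x ^ n)
    (by fun_prop) (fun x => ?_) (hc.hasPrimitive_beta ht)
  · rw [h.integral_eq_sub le_rfl ht.le le_rfl, beta_zero]
    simp
  · have := (hasDerivAt_pow (n + 1) x).div_const ((n : ℝ) + 1)
    refine this.congr_deriv ?_
    rw [div_eq_iff (by positivity), Nat.add_sub_cancel]
    push_cast
    ring

theorem IsSolution.mul_alpha_pow (hc : IsSolution c) {t : ℝ} (ht : 0 < t) {a m : ℕ}
    (hm : 1 ≤ m) :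
    c t a m * alpha c t ^ a = c 0 a m + ∫ s in (0 : ℝ)..t, gain (c s) a m * alpha c s ^ a := by
  have h := ((hc.hasPrimitive ht (a := a) hm).mul (hc.hasPrimitive_alpha_pow ht a)).integral_eq_sub
    le_rfl ht.le le_rfl
  rw [← hc.eq ht.le hm, ← hc.eq le_rfl hm, alpha_zero, one_pow, mul_one] at h
  rw [eq_add_of_sub_eq' h.symm]
  congr 1
  refine intervalIntegral.integral_congr fun s hs => ?_
  rw [uIcc_of_le ht.le] at hs
  rw [← hc.eq hs.1 hm, hc.loss_eq hs.1]
  ring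

end Solution

end ArmsModel

/-! ### The explicit formula and the identity `αA = F(1/α, β)` -/

namespace ArmsModel

/-- The coefficient of `z ^ i β ^ n` in the Burgers series of `∑ ν j z ^ j`. -/
noncomputable def burgersNum (ν : ℕ → ℝ≥0) (n i : ℕ) : ℝ :=
  (PowerSeries.coeff i (PowerSeries.coeff n (burgers (PowerSeries.mk ν))) : ℝ≥0)

theorem burgersNum_eq (ν : ℕ → ℝ≥0) (n i : ℕ) :
    burgersNum ν n i = (i + n)! / (i ! * (n + 1)!) *
      convPow (fun j => (ν j : ℝ)) (n + 1) (i + n) := by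
  have h := coeff_coeff_burgers_pow ν n 0 i
  rw [zero_add, pow_one] at h
  rw [burgersNum, h, Nat.factorial_succ]
  push_cast
  have : (n ! : ℝ) ≠ 0 := by positivity
  have : (i ! : ℝ) ≠ 0 := by positivity
  have : (n : ℝ) + 1 ≠ 0 := by positivity
  congr 1
  field_simp
  ring

/-- The left side is a coefficient of `F ^ 2`, so this is the case `p = 1` of the inversion formula.
In the gain term the `2` cancels the factor `1/2`, and `n + 1` disappears when `β ^ n` is
integrated. -/
theorem sum_burgersNum_mul (ν : ℕ → ℝ≥0) (n a : ℕ) :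
    ∑ b ∈ Finset.range (a + 1), ∑ l ∈ Finset.range (n + 1),
      burgersNum ν l b * burgersNum ν (n - l) (a - b) =
    2 * (n + 1) * ((a + n)! / (a ! * (n + 2)!) *
      convPow (fun j => (ν j : ℝ)) (n + 2) (a + n)) := by
  have h := coeff_coeff_burgers_pow ν n 1 a
  rw [one_add_one_eq_two, sq, PowerSeries.coeff_mul, map_sum] at h
  simp only [PowerSeries.coeff_mul, Finset.Nat.sum_antidiagonal_eq_sum_range_succ_mk] at h
  push_cast at h
  rw [Finset.sum_comm]
  refine h.trans ?_
  rw [Nat.factorial_succ, Nat.factorial_succ]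
  push_cast
  have : (n ! : ℝ) ≠ 0 := by positivity
  have : (a ! : ℝ) ≠ 0 := by positivity
  have : (n : ℝ) + 1 ≠ 0 := by positivity
  have : (n : ℝ) + 2 ≠ 0 := by positivity
  have : (2 : ℝ) + n ≠ 0 := by positivity
  rw [← mul_assoc]
  congr 1
  field_simp
  ring

theorem gain_mul_pow {ν : ℕ → ℝ≥0} {c : ℕ → ℕ → ℝ} {α β : ℝ} {n : ℕ}
    (h : ∀ l ≤ n, ∀ b : ℕ, ((b : ℝ) + 1) * c (b + 1) (l + 1) * α ^ (b + 1) = burgersNum ν l b * β ^ l)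
    (a : ℕ) :
    gain c a (n + 2) * α ^ (a + 2) = (n + 1) * ((a + n)! / (a ! * (n + 2)!) *
      convPow (fun j => (ν j : ℝ)) (n + 2) (a + n)) * β ^ n := by
  have hr : ∀ (k : ℕ) (f : ℕ → ℝ), ∑ i ∈ Finset.Icc 1 (k + 1), f i =
      ∑ i ∈ Finset.range (k + 1), f (i + 1) := by
    intro k f
    rw [← Finset.Ico_succ_right_eq_Icc, Finset.sum_Ico_eq_sum_range]
    simp [add_comm]
  rw [gain, show n + 2 - 1 = n + 1 by omega, hr]
  simp only [hr]
  rw [mul_assoc, Finset.sum_mul]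
  have key : ∀ b ∈ Finset.range (a + 1),
      (∑ l ∈ Finset.range (n + 1), ((b + 1 : ℕ) : ℝ) * ((a + 2 - (b + 1) : ℕ) : ℝ) *
        c (b + 1) (l + 1) * c (a + 2 - (b + 1)) (n + 2 - (l + 1))) * α ^ (a + 2) =
      (∑ l ∈ Finset.range (n + 1), burgersNum ν l b * burgersNum ν (n - l) (a - b)) * β ^ n := by
    intro b hb
    rw [Finset.sum_mul, Finset.sum_mul]
    refine Finset.sum_congr rfl fun l hl => ?_
    -- The partners have `b + 1` and `d + 1` arms with `b + d = a`, so their weights share out `α ^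
    -- (a + 2)` exactly.
    obtain ⟨d, rfl⟩ := Nat.exists_eq_add_of_le (Nat.lt_succ_iff.1 (Finset.mem_range.1 hb))
    obtain ⟨e, rfl⟩ := Nat.exists_eq_add_of_le (Nat.lt_succ_iff.1 (Finset.mem_range.1 hl))
    rw [show b + d + 2 - (b + 1) = d + 1 by omega, show l + e + 2 - (l + 1) = e + 1 by omega,
      Nat.add_sub_cancel_left, Nat.add_sub_cancel_left]
    have h1 := h l (by omega) b
    have h2 := h e (by omega) d
    push_cast
    calc _ = (((b : ℝ) + 1) * c (b + 1) (l + 1) * α ^ (b + 1)) *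
          (((d : ℝ) + 1) * c (d + 1) (e + 1) * α ^ (d + 1)) := by ring
      _ = _ := by rw [h1, h2]; ring
  rw [Finset.sum_congr rfl key, ← Finset.sum_mul, sum_burgersNum_mul]
  ring

section Solution

variable {c : ℝ → ℕ → ℕ → ℝ} {ν : ℕ → ℝ≥0}

theorem IsSolution.explicit_of_forall_le (hc : IsSolution c) {n : ℕ}
    (h0 : ∀ a, c 0 a (n + 2) = 0)
    (h : ∀ t, 0 ≤ t → ∀ l ≤ n, ∀ b : ℕ, ((b : ℝ) + 1) * c t (b + 1) (l + 1) * alpha c t ^ (b + 1) =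
      burgersNum ν l b * beta c t ^ l) {t : ℝ} (ht : 0 ≤ t) (a : ℕ) :
    c t a (n + 2) * alpha c t ^ a = (a + n)! / (a ! * (n + 2)!) *
      convPow (fun j => (ν j : ℝ)) (n + 2) (a + n) * beta c t ^ (n + 1) := by
  rcases ht.eq_or_lt with rfl | ht
  · simp [h0, beta_zero]
  rw [hc.mul_alpha_pow ht (by omega), h0, zero_add]
  have key : ∀ s ∈ uIcc 0 t, gain (c s) a (n + 2) * alpha c s ^ a =
      ((n + 1) * ((a + n)! / (a ! * (n + 2)!) * convPow (fun j => (ν j : ℝ)) (n + 2) (a + n))) *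
        (beta c s ^ n * (1 / alpha c s ^ 2)) := by
    intro s hs
    rw [uIcc_of_le ht.le] at hs
    have h1 := gain_mul_pow (h s hs.1) a
    rw [pow_add, ← mul_assoc] at h1
    rw [eq_div_of_mul_eq (pow_pos (alpha_pos c s) 2).ne' h1]
    ring
  rw [intervalIntegral.integral_congr key, intervalIntegral.integral_const_mul,
    hc.integral_beta_pow ht]
  have : (n : ℝ) + 1 ≠ 0 := by positivity
  field_simp

/-- Strong induction on the mass: the gain at mass `n + 2` involves only smaller masses, and the
factor `b + 1` turns `1/(b+1)!` into `1/b!`. -/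
theorem IsSolution.succ_mul_eq_burgersNum (hc : IsSolution c)
    (h0 : ∀ a m, 2 ≤ m → c 0 a m = 0) (hν : ∀ j, (ν j : ℝ) = ((j : ℝ) + 1) * c 0 (j + 1) 1)
    (n : ℕ) {t : ℝ} (ht : 0 ≤ t) (b : ℕ) :
    ((b : ℝ) + 1) * c t (b + 1) (n + 1) * alpha c t ^ (b + 1) =
      burgersNum ν n b * beta c t ^ n := by
  induction n using Nat.strong_induction_on generalizing t b with
  | _ n ih =>
  cases n with
  | zero =>
    have h1 : burgersNum ν 0 b = ν b := by
      rw [burgersNum, coeff_zero_burgers, PowerSeries.coeff_mk]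
    rw [h1, hν, zero_add, pow_zero, mul_one, mul_assoc]
    congr 1
    rcases ht.eq_or_lt with rfl | ht
    · simp [alpha_zero]
    · rw [hc.mul_alpha_pow ht le_rfl]
      simp [gain]
  | succ n =>
    rw [mul_assoc, show n + 1 + 1 = n + 2 by ring,
      hc.explicit_of_forall_le (fun a => h0 a _ (by omega))
        (fun s hs l hl b => ih l (by omega) hs b) ht, burgersNum_eq,
      show b + 1 + n = b + (n + 1) by ring, Nat.factorial_succ b]
    push_cast
    have : (b ! : ℝ) ≠ 0 := by positivity
    have : (b : ℝ) + 1 ≠ 0 := by positivity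
    field_simp

theorem IsSolution.explicit (hc : IsSolution c)
    (h0 : ∀ a m, 2 ≤ m → c 0 a m = 0) (hν : ∀ j, (ν j : ℝ) = ((j : ℝ) + 1) * c 0 (j + 1) 1)
    (n : ℕ) {t : ℝ} (ht : 0 ≤ t) (a : ℕ) :
    c t a (n + 2) * alpha c t ^ a = (a + n)! / (a ! * (n + 2)!) *
      convPow (fun j => (ν j : ℝ)) (n + 2) (a + n) * beta c t ^ (n + 1) :=
  hc.explicit_of_forall_le (fun a => h0 a _ (by omega))
    (fun _ hs l _ b => hc.succ_mul_eq_burgersNum h0 hν l hs b) ht a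

theorem IsSolution.ofReal_alpha_mul_arms (hc : IsSolution c)
    (h0 : ∀ a m, 2 ≤ m → c 0 a m = 0) (hν : ∀ j, (ν j : ℝ) = ((j : ℝ) + 1) * c 0 (j + 1) 1)
    {t : ℝ} (ht : 0 ≤ t) (hβ : 0 ≤ beta c t) :
    ENNReal.ofReal (alpha c t) * arms (c t) =
      burgersSum ν (ENNReal.ofReal (alpha c t)⁻¹) (ENNReal.ofReal (beta c t)) := by
  have hα := alpha_pos c t
  rw [arms, moment, ENNReal.tsum_prod', tsum_eq_zero_add' ENNReal.summable]
  simp only [Nat.cast_zero, zero_mul, ENNReal.ofReal_zero, tsum_zero, zero_add]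
  rw [ENNReal.tsum_comm, ← ENNReal.tsum_mul_left, burgersSum, evalENNReal_apply]
  refine tsum_congr fun n => ?_
  rw [evalInner, evalENNReal_apply, ← ENNReal.tsum_mul_left, ← ENNReal.tsum_mul_right]
  refine tsum_congr fun b => ?_
  have h := hc.succ_mul_eq_burgersNum h0 hν n ht b
  have e : alpha c t * (((b + 1 : ℕ) : ℝ) * c t (b + 1) (n + 1)) =
      burgersNum ν n b * (alpha c t)⁻¹ ^ b * beta c t ^ n := by
    rw [mul_right_comm, ← h]
    push_cast
    rw [pow_succ, inv_pow]
    field_simp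
  rw [← ENNReal.ofReal_mul hα.le, e, ENNReal.ofReal_mul (by unfold burgersNum; positivity),
    ENNReal.ofReal_mul (by unfold burgersNum; positivity), ENNReal.ofReal_pow (by positivity),
    ENNReal.ofReal_pow hβ, burgersNum, ENNReal.ofReal_coe_nnreal]
  rfl

/-- Particles with one arm and mass one are never created, so `α_t c_t(1,1)` is conserved. This is
what bounds `β`. -/
theorem IsSolution.initial_le_alpha_mul_arms (hc : IsSolution c) {t : ℝ} (ht : 0 ≤ t) :
    ENNReal.ofReal (c 0 1 1) ≤ ENNReal.ofReal (alpha c t) * arms (c t) := by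
  have h : c 0 1 1 = alpha c t * (((1 : ℕ) : ℝ) * c t 1 1) := by
    rcases ht.eq_or_lt with rfl | ht
    · simp [alpha_zero]
    · have := hc.mul_alpha_pow ht (a := 1) (m := 1) le_rfl
      simp only [gain, pow_one] at this
      rw [mul_comm, Nat.cast_one, one_mul, this]
      simp
  rw [h, ENNReal.ofReal_mul (alpha_pos c t).le]
  gcongr
  exact ENNReal.le_tsum (f := fun p : ℕ × ℕ => ENNReal.ofReal ((p.1 : ℝ) * c t p.1 (p.2 + 1))) (1, 0)

end Solution

end ArmsModel

/-! ### Barriers and the limit of `β` -/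

namespace ArmsModel

/-- The real power series `∑ ν j x ^ j`. -/
noncomputable def genReal (ν : ℕ → ℝ≥0) (x : ℝ) : ℝ := ∑' j, (ν j : ℝ) * x ^ j

theorem genReal_nonneg (ν : ℕ → ℝ≥0) {x : ℝ} (hx : 0 ≤ x) : 0 ≤ genReal ν x :=
  tsum_nonneg fun j => by positivity

theorem genSeries_ofReal {ν : ℕ → ℝ≥0} {x : ℝ} (hx : 0 ≤ x)
    (hs : Summable fun j => (ν j : ℝ) * x ^ j) :
    genSeries ν (ENNReal.ofReal x) = ENNReal.ofReal (genReal ν x) := by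
  rw [genReal, ENNReal.ofReal_tsum_of_nonneg (fun j => by positivity) hs]
  refine tsum_congr fun j => ?_
  rw [ENNReal.ofReal_mul (by positivity), ENNReal.ofReal_pow hx, ENNReal.ofReal_coe_nnreal]

theorem summable_of_genSeries_ne_top {ν : ℕ → ℝ≥0} {x : ℝ} (hx : 0 ≤ x)
    (h : genSeries ν (ENNReal.ofReal x) ≠ ∞) : Summable fun j => (ν j : ℝ) * x ^ j := by
  have := ENNReal.summable_toReal h
  simpa [ENNReal.toReal_mul, ENNReal.toReal_pow, ENNReal.toReal_ofReal hx] using this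

theorem summable_mul_pow_of_le {ν : ℕ → ℝ≥0} {x y : ℝ} (hx : 0 ≤ x) (hxy : x ≤ y)
    (hs : Summable fun j => (ν j : ℝ) * y ^ j) : Summable fun j => (ν j : ℝ) * x ^ j :=
  hs.of_nonneg_of_le (fun j => by positivity) fun j => by gcongr

theorem genReal_le_of_le {ν : ℕ → ℝ≥0} {x y : ℝ} (hx : 0 ≤ x) (hxy : x ≤ y)
    (hs : Summable fun j => (ν j : ℝ) * y ^ j) : genReal ν x ≤ genReal ν y :=
  (summable_mul_pow_of_le hx hxy hs).tsum_le_tsum (fun j => by gcongr) hs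

theorem continuousOn_genReal {ν : ℕ → ℝ≥0} {y : ℝ}
    (hs : Summable fun j => (ν j : ℝ) * y ^ j) : ContinuousOn (genReal ν) (Icc 0 y) := by
  refine continuousOn_tsum (fun j => by fun_prop) hs fun j x hx => ?_
  have := hx.1
  rw [Real.norm_of_nonneg (by positivity)]
  gcongr
  exact hx.2

theorem of_last_exit {P : ℝ → Prop} {t : ℝ} (ht : 0 ≤ t) (hcl : IsClosed {s ∈ Icc 0 t | P s})
    (h0 : P 0) (hstep : ∀ s ∈ Icc 0 t, P s → (∀ r ∈ Ioc s t, ¬ P r) → P t) : P t := by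
  have hcomp : IsCompact {s ∈ Icc 0 t | P s} :=
    isCompact_Icc.of_isClosed_subset hcl fun s hs => hs.1
  have hmem := hcomp.sSup_mem ⟨0, ⟨le_rfl, ht⟩, h0⟩
  refine hstep _ hmem.1 hmem.2 fun r hr hP => ?_
  exact absurd (le_csSup hcomp.bddAbove ⟨⟨hmem.1.1.trans hr.1.le, hr.2⟩, hP⟩) (not_le.2 hr.1)

section Solution

variable {c : ℝ → ℕ → ℕ → ℝ} {ν : ℕ → ℝ≥0}

theorem IsSolution.beta_le_beta (hc : IsSolution c) {s t : ℝ} (hs : 0 ≤ s) (hst : s ≤ t) :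
    beta c s ≤ beta c t := by
  rcases hst.eq_or_lt with rfl | h
  · exact le_rfl
  · rw [← sub_nonneg,
      ← (hc.hasPrimitive_beta (hs.trans_lt h)).integral_eq_sub hs hst le_rfl]
    exact intervalIntegral.integral_nonneg hst fun u _ => by positivity

theorem IsSolution.beta_nonneg (hc : IsSolution c) {t : ℝ} (ht : 0 ≤ t) : 0 ≤ beta c t := by
  simpa [beta_zero] using hc.beta_le_beta le_rfl ht

theorem IsSolution.inv_alpha_le (hc : IsSolution c) {s t κ : ℝ} (hs : 0 ≤ s) (hst : s ≤ t)
    (hκ : 0 ≤ κ)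
    (h : ∀ r ∈ Ioc s t, ENNReal.ofReal κ ≤ ENNReal.ofReal (alpha c r) * arms (c r)) :
    (alpha c t)⁻¹ + κ * (beta c t - beta c s) ≤ (alpha c s)⁻¹ := by
  rcases hst.eq_or_lt with rfl | hlt
  · simp
  have hT := hs.trans_lt hlt
  have hsub : uIcc s t ⊆ uIcc 0 t := by
    rw [uIcc_of_le hst, uIcc_of_le hT.le]; exact Icc_subset_Icc hs le_rfl
  have hz := (hc.hasPrimitive_inv_alpha hT).integral_eq_sub hs hst le_rfl
  have hb := (hc.hasPrimitive_beta hT).integral_eq_sub hs hst le_rfl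
  rw [← hb, ← intervalIntegral.integral_const_mul]
  rw [intervalIntegral.integral_neg] at hz
  have hle : ∫ r in s..t, κ * (1 / alpha c r ^ 2) ≤
      ∫ r in s..t, (alpha c r * (arms (c r)).toReal) * (1 / alpha c r ^ 2) := by
    refine intervalIntegral.integral_mono_ae_restrict hst
      (((hc.intervalIntegrable_alpha hT).const_mul κ).mono_set hsub) ?_ ?_
    · have := ((hc.hasPrimitive_inv_alpha hT).intervalIntegrable).neg.mono_set hsub
      simpa only [Pi.neg_def, neg_neg] using this
    · rw [EventuallyLE, ae_restrict_iff' measurableSet_Icc]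
      -- The left endpoint is dropped: the last-exit argument controls only times strictly after
      -- `s`.
      have hne : ∀ᵐ r : ℝ, r ≠ s := by simp [ae_iff]
      filter_upwards [hc.ae_arms_lt_top hT, hne] with r hr hrs hrm
      have hr1 : r ∈ Ioc s t := ⟨lt_of_le_of_ne hrm.1 (Ne.symm hrs), hrm.2⟩
      have h1 := hr ⟨hs.trans_lt hr1.1, hrm.2⟩
      have h2 := ENNReal.toReal_mono (ENNReal.mul_ne_top ENNReal.ofReal_ne_top h1.ne) (h r hr1)
      rw [ENNReal.toReal_mul, ENNReal.toReal_ofReal hκ,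
        ENNReal.toReal_ofReal (alpha_pos c r).le] at h2
      gcongr
  linarith

theorem IsSolution.le_inv_alpha (hc : IsSolution c) {s t κ : ℝ} (hs : 0 ≤ s) (hst : s ≤ t)
    (hκ : 0 ≤ κ)
    (h : ∀ r ∈ Ioc s t, ENNReal.ofReal (alpha c r) * arms (c r) ≤ ENNReal.ofReal κ) :
    (alpha c s)⁻¹ ≤ (alpha c t)⁻¹ + κ * (beta c t - beta c s) := by
  rcases hst.eq_or_lt with rfl | hlt
  · simp
  have hT := hs.trans_lt hlt
  have hsub : uIcc s t ⊆ uIcc 0 t := by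
    rw [uIcc_of_le hst, uIcc_of_le hT.le]; exact Icc_subset_Icc hs le_rfl
  have hz := (hc.hasPrimitive_inv_alpha hT).integral_eq_sub hs hst le_rfl
  have hb := (hc.hasPrimitive_beta hT).integral_eq_sub hs hst le_rfl
  rw [← hb, ← intervalIntegral.integral_const_mul]
  rw [intervalIntegral.integral_neg] at hz
  have hle : ∫ r in s..t, (alpha c r * (arms (c r)).toReal) * (1 / alpha c r ^ 2) ≤
      ∫ r in s..t, κ * (1 / alpha c r ^ 2) := by
    refine intervalIntegral.integral_mono_ae_restrict hst ?_
      (((hc.intervalIntegrable_alpha hT).const_mul κ).mono_set hsub) ?_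
    · have := ((hc.hasPrimitive_inv_alpha hT).intervalIntegrable).neg.mono_set hsub
      simpa only [Pi.neg_def, neg_neg] using this
    · rw [EventuallyLE, ae_restrict_iff' measurableSet_Icc]
      have hne : ∀ᵐ r : ℝ, r ≠ s := by simp [ae_iff]
      filter_upwards [hne] with r hrs hrm
      have h2 := ENNReal.toReal_le_of_le_ofReal hκ
        (h r ⟨lt_of_le_of_ne hrm.1 (Ne.symm hrs), hrm.2⟩)
      rw [ENNReal.toReal_mul, ENNReal.toReal_ofReal (alpha_pos c r).le] at h2
      gcongr
  linarith

theorem IsSolution.inv_alpha_anti (hc : IsSolution c) {s t : ℝ} (hs : 0 ≤ s) (hst : s ≤ t) :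
    (alpha c t)⁻¹ ≤ (alpha c s)⁻¹ := by
  simpa using hc.inv_alpha_le hs hst le_rfl fun r _ => by simp

theorem IsSolution.initial_mul_beta_le_one (hc : IsSolution c) {t : ℝ} (ht : 0 ≤ t)
    (h1 : 0 ≤ c 0 1 1) : c 0 1 1 * beta c t ≤ 1 := by
  -- Since `αA ≥ μ(1)`, one gets `0 < 1/α ≤ 1 - μ(1) β`.
  have h := hc.inv_alpha_le le_rfl ht h1 fun r hr => hc.initial_le_alpha_mul_arms hr.1.le
  rw [beta_zero, alpha_zero, sub_zero, inv_one] at h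
  have := inv_pos.2 (alpha_pos c t)
  linarith

theorem IsSolution.exists_tendsto_beta (hc : IsSolution c) (h1 : 0 < c 0 1 1) :
    ∃ B, 0 < B ∧ Tendsto (beta c) atTop (𝓝 B) ∧ ∀ t, 0 ≤ t → beta c t ≤ B := by
  have hmono : Monotone fun t => beta c (max t 0) := fun s t h =>
    hc.beta_le_beta (le_max_right _ _) (max_le_max h le_rfl)
  have hbdd : BddAbove (range fun t => beta c (max t 0)) := by
    refine ⟨1 / c 0 1 1, ?_⟩
    rintro _ ⟨t, rfl⟩
    rw [le_div_iff₀ h1, mul_comm]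
    exact hc.initial_mul_beta_le_one (le_max_right _ _) h1.le
  have hle : ∀ t, 0 ≤ t → beta c t ≤ ⨆ t, beta c (max t 0) := fun t ht => by
    simpa [max_eq_left ht] using le_ciSup hbdd t
  refine ⟨⨆ t, beta c (max t 0), ?_, ?_, hle⟩
  · refine lt_of_lt_of_le ?_ (hle 1 zero_le_one)
    exact intervalIntegral.intervalIntegral_pos_of_pos (hc.intervalIntegrable_alpha one_pos)
      (fun s => by have := alpha_pos c s; positivity) one_pos
  · refine (tendsto_atTop_ciSup hmono hbdd).congr' ?_
    filter_upwards [eventually_ge_atTop 0] with t ht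
    rw [max_eq_left ht]

theorem IsSolution.mul_inv_alpha_sq_le_beta (hc : IsSolution c) {t : ℝ} (ht : 0 < t) :
    t * (alpha c t)⁻¹ ^ 2 ≤ beta c t := by
  have h : ∫ _ in (0 : ℝ)..t, (alpha c t)⁻¹ ^ 2 ≤ beta c t := by
    refine intervalIntegral.integral_mono_on ht.le intervalIntegrable_const
      (hc.intervalIntegrable_alpha ht) fun s hs => ?_
    rw [one_div, ← inv_pow]
    have := inv_pos.2 (alpha_pos c t)
    exact pow_le_pow_left₀ this.le (hc.inv_alpha_anti hs.1 hs.2) 2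
  simpa using h

/-- As `1/α` is nonincreasing, `t / α_t ^ 2 ≤ β_t`, and `β` is bounded. -/
theorem IsSolution.tendsto_inv_alpha (hc : IsSolution c) (h1 : 0 < c 0 1 1) :
    Tendsto (fun t => (alpha c t)⁻¹) atTop (𝓝 0) := by
  obtain ⟨B, -, -, hB⟩ := hc.exists_tendsto_beta h1
  have hsq : Tendsto (fun t => (alpha c t)⁻¹ ^ 2) atTop (𝓝 0) := by
    refine squeeze_zero' (Eventually.of_forall fun t => by positivity) ?_
      (tendsto_const_nhds.div_atTop tendsto_id : Tendsto (fun t : ℝ => B / t) atTop (𝓝 0))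
    filter_upwards [eventually_gt_atTop 0] with t ht
    rw [le_div_iff₀ ht, mul_comm]
    exact (hc.mul_inv_alpha_sq_le_beta ht).trans (hB t ht.le)
  have := (Real.continuous_sqrt.tendsto 0).comp hsq
  rw [Real.sqrt_zero] at this
  refine this.congr fun t => ?_
  exact Real.sqrt_sq (inv_pos.2 (alpha_pos c t)).le

theorem IsSolution.continuousOn_inv_alpha (hc : IsSolution c) (T : ℝ) :
    ContinuousOn (fun t => (alpha c t)⁻¹) (Icc 0 T) := by
  rcases lt_or_ge 0 T with hT | hT
  · exact (hc.hasPrimitive_inv_alpha hT).continuousOn hT.le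
  · exact (subsingleton_Icc_of_ge hT).continuousOn _

theorem IsSolution.continuousOn_beta (hc : IsSolution c) (T : ℝ) :
    ContinuousOn (beta c) (Icc 0 T) := by
  rcases lt_or_ge 0 T with hT | hT
  · exact (hc.hasPrimitive_beta hT).continuousOn hT.le
  · exact (subsingleton_Icc_of_ge hT).continuousOn _

/-- Where the inequality fails, `x` is a supersolution, so `αA ≤ k(x)` and `1/α + β k(x)` does not
decrease. It cannot sink further below `x` after a last exit. -/
theorem IsSolution.le_inv_alpha_add_beta_mul (hc : IsSolution c)
    (h0 : ∀ a m, 2 ≤ m → c 0 a m = 0) (hν : ∀ j, (ν j : ℝ) = ((j : ℝ) + 1) * c 0 (j + 1) 1)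
    {x : ℝ} (hx : x ∈ Icc (0 : ℝ) 1) (hs : Summable fun j => (ν j : ℝ) * x ^ j) {t : ℝ}
    (ht : 0 ≤ t) : x ≤ (alpha c t)⁻¹ + beta c t * genReal ν x := by
  have hg := genReal_nonneg ν hx.1
  refine of_last_exit (P := fun t => x ≤ (alpha c t)⁻¹ + beta c t * genReal ν x) ht ?_ ?_ ?_
  · exact isClosed_Icc.isClosed_le continuousOn_const
      ((hc.continuousOn_inv_alpha t).add ((hc.continuousOn_beta t).mul_const _))
  · simpa [alpha_zero, beta_zero] using hx.2
  · intro s hst hP hr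
    have h := hc.le_inv_alpha hst.1 hst.2 hg fun r hrm => ?_
    · linarith
    · have hr0 : 0 ≤ r := hst.1.trans hrm.1.le
      have hβ := hc.beta_nonneg hr0
      rw [hc.ofReal_alpha_mul_arms h0 hν hr0 hβ, ← genSeries_ofReal hx.1 hs]
      refine burgersSum_le_genSeries ?_
      rw [genSeries_ofReal hx.1 hs, ← ENNReal.ofReal_mul hβ, ← ENNReal.ofReal_add
        (inv_pos.2 (alpha_pos c r)).le (by positivity)]
      exact ENNReal.ofReal_le_ofReal (not_le.1 (hr r hrm)).le

theorem IsSolution.genSeries_one_le (hc : IsSolution c)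
    (h0 : ∀ a m, 2 ≤ m → c 0 a m = 0) (hν : ∀ j, (ν j : ℝ) = ((j : ℝ) + 1) * c 0 (j + 1) 1)
    {t : ℝ} (ht : 0 ≤ t) (h : ∀ x ∈ Icc (0 : ℝ) 1, (Summable fun j => (ν j : ℝ) * x ^ j) →
      ¬ (alpha c t)⁻¹ + beta c t * genReal ν x ≤ x) (hβ : 0 < beta c t) :
    genSeries ν 1 ≤ ENNReal.ofReal (alpha c t) * arms (c t) := by
  rw [hc.ofReal_alpha_mul_arms h0 hν ht hβ.le]
  refine genSeries_one_le_burgersSum fun x hx hle => ?_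
  have hxt : x ≠ ∞ := (hx.trans_lt ENNReal.one_lt_top).ne
  rw [← ENNReal.ofReal_toReal hxt] at hle
  have hx0 : 0 ≤ x.toReal := ENNReal.toReal_nonneg
  have hs : Summable fun j => (ν j : ℝ) * x.toReal ^ j := by
    refine summable_of_genSeries_ne_top hx0 fun htop => ?_
    rw [htop, ENNReal.mul_top (by simpa using hβ), add_top, top_le_iff] at hle
    exact ENNReal.ofReal_ne_top hle
  have hg := genReal_nonneg ν hx0
  rw [genSeries_ofReal hx0 hs, ← ENNReal.ofReal_mul hβ.le, ← ENNReal.ofReal_add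
    (inv_pos.2 (alpha_pos c t)).le (by positivity), ENNReal.ofReal_le_ofReal_iff hx0] at hle
  refine h _ ⟨hx0, ?_⟩ hs hle
  exact ENNReal.toReal_mono ENNReal.one_ne_top hx

theorem IsSolution.beta_pos (hc : IsSolution c) {t : ℝ} (ht : 0 < t) : 0 < beta c t :=
  intervalIntegral.intervalIntegral_pos_of_pos (hc.intervalIntegrable_alpha ht)
    (fun s => by have := alpha_pos c s; positivity) ht

/-- After a last time with a supersolution `x`, one would have `αA ≥ k(1) ≥ k(x)`. Then `1/α + β
k(x)` does not increase and the same `x` keeps working. -/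
theorem IsSolution.exists_inv_alpha_add_beta_mul_le (hc : IsSolution c)
    (h0 : ∀ a m, 2 ≤ m → c 0 a m = 0) (hν : ∀ j, (ν j : ℝ) = ((j : ℝ) + 1) * c 0 (j + 1) 1)
    (hs : Summable fun j => (ν j : ℝ)) {t : ℝ} (ht : 0 ≤ t) :
    ∃ x ∈ Icc (0 : ℝ) 1, (alpha c t)⁻¹ + beta c t * genReal ν x ≤ x := by
  have hs1 : Summable fun j => (ν j : ℝ) * 1 ^ j := by simpa using hs
  refine of_last_exit (P := fun t => ∃ x ∈ Icc (0 : ℝ) 1,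
    (alpha c t)⁻¹ + beta c t * genReal ν x ≤ x) ht ?_ ?_ ?_
  -- The set of good times is the projection of a compact set of pairs `(s, x)`.
  · have hcl : IsClosed {p ∈ Icc (0 : ℝ) t ×ˢ Icc (0 : ℝ) 1 |
        (alpha c p.1)⁻¹ + beta c p.1 * genReal ν p.2 ≤ p.2} := by
      refine (isClosed_Icc.prod isClosed_Icc).isClosed_le ?_ continuousOn_snd
      refine ((hc.continuousOn_inv_alpha t).comp continuousOn_fst fun p hp => hp.1).add
        (((hc.continuousOn_beta t).comp continuousOn_fst fun p hp => hp.1).mul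
          ((continuousOn_genReal hs1).comp continuousOn_snd fun p hp => hp.2))
    have hcomp := (isCompact_Icc.prod isCompact_Icc).of_isClosed_subset hcl fun p hp => hp.1
    convert (hcomp.image continuous_fst).isClosed using 1
    ext s
    constructor
    · rintro ⟨h1, x, hx, h2⟩
      exact ⟨(s, x), ⟨⟨h1, hx⟩, h2⟩, rfl⟩
    · rintro ⟨⟨s, x⟩, ⟨⟨h1, hx⟩, h2⟩, rfl⟩
      exact ⟨h1, x, hx, h2⟩
  · exact ⟨1, ⟨zero_le_one, le_rfl⟩, by simp [alpha_zero, beta_zero]⟩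
  · rintro s hst ⟨x, hx, hP⟩ hr
    refine ⟨x, hx, ?_⟩
    have h := hc.inv_alpha_le hst.1 hst.2 (genReal_nonneg ν zero_le_one) fun r hrm => ?_
    · have hle := mul_le_mul_of_nonneg_right (genReal_le_of_le hx.1 hx.2 hs1)
        (sub_nonneg.2 (hc.beta_le_beta hst.1 hst.2))
      linarith
    · rw [← genSeries_ofReal zero_le_one hs1, ENNReal.ofReal_one]
      have hr0 : 0 < r := hst.1.trans_lt hrm.1
      exact hc.genSeries_one_le h0 hν hr0.le (fun y hy _ hle => hr r hrm ⟨y, hy, hle⟩)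
        (hc.beta_pos hr0)

/-- The limit of `beta` is the supremum of `x / k x`. -/
theorem IsSolution.limit_beta (hc : IsSolution c)
    (h0 : ∀ a m, 2 ≤ m → c 0 a m = 0) (hν : ∀ j, (ν j : ℝ) = ((j : ℝ) + 1) * c 0 (j + 1) 1)
    (h1 : 0 < c 0 1 1) {B : ℝ} (hB : Tendsto (beta c) atTop (𝓝 B)) :
    (∀ x ∈ Icc (0 : ℝ) 1, (Summable fun j => (ν j : ℝ) * x ^ j) → x ≤ B * genReal ν x) ∧
    ∀ b < B, ∃ x ∈ Ioc (0 : ℝ) 1, (Summable fun j => (ν j : ℝ) * x ^ j) ∧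
      b * genReal ν x ≤ x := by
  constructor
  · intro x hx hs
    have h := (hc.tendsto_inv_alpha h1).add (hB.mul_const (genReal ν x))
    rw [zero_add] at h
    refine ge_of_tendsto h ?_
    filter_upwards [eventually_ge_atTop 0] with t ht
    exact hc.le_inv_alpha_add_beta_mul h0 hν hx hs ht
  · intro b hb
    obtain ⟨T, hT⟩ := eventually_atTop.1 ((hB.eventually_const_lt hb).and
      (eventually_gt_atTop 0))
    have key : ∃ t, T ≤ t ∧ ∃ x ∈ Icc (0 : ℝ) 1, (Summable fun j => (ν j : ℝ) * x ^ j) ∧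
        (alpha c t)⁻¹ + beta c t * genReal ν x ≤ x := by
      by_cases hs : Summable fun j => (ν j : ℝ)
      · obtain ⟨x, hx, h⟩ := hc.exists_inv_alpha_add_beta_mul_le h0 hν hs (hT T le_rfl).2.le
        exact ⟨T, le_rfl, x, hx, summable_mul_pow_of_le hx.1 hx.2 (by simpa using hs), h⟩
      · have hT0 := (hT T le_rfl).2
        -- When `k(1) = ∞`, the absence of a supersolution would force `A_t = ∞`, which happens only
        -- on a null set of times.
        obtain ⟨t, htm, ht⟩ : ∃ t ∈ Ioc T (T + 1), arms (c t) < ∞ := by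
          by_contra! hcon
          have hae := hc.ae_arms_lt_top (show 0 < T + 1 by linarith)
          have : volume (Ioc T (T + 1)) = 0 := by
            refine measure_mono_null (fun t ht => ?_) (ae_iff.1 hae)
            simp only [mem_ofPred_eq, Classical.not_imp]
            exact ⟨⟨hT0.trans ht.1, ht.2⟩, not_lt.2 (hcon t ht)⟩
          simp at this
        refine ⟨t, htm.1.le, ?_⟩
        by_contra! hcon
        have htop : genSeries ν 1 = ∞ := by
          by_contra hne
          refine hs ?_
          simpa using summable_of_genSeries_ne_top zero_le_one (by simpa using hne)
        have ht0 := (hT t htm.1.le).2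
        have hle := hc.genSeries_one_le h0 hν ht0.le (fun x hx hsx => not_le.2 (hcon x hx hsx))
          (hc.beta_pos ht0)
        rw [htop, top_le_iff] at hle
        exact ENNReal.mul_ne_top ENNReal.ofReal_ne_top ht.ne hle
    obtain ⟨t, htT, x, hx, hs, hle⟩ := key
    have hz := inv_pos.2 (alpha_pos c t)
    have hg := genReal_nonneg ν hx.1
    obtain ⟨hbt, ht0⟩ := hT t htT
    have hβ := mul_nonneg (hc.beta_nonneg ht0.le) hg
    refine ⟨x, ⟨by linarith, hx.2⟩, hs, ?_⟩
    have := mul_le_mul_of_nonneg_right hbt.le hg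
    linarith

end Solution

end ArmsModel

/-! ### Convexity, tangency points and minimisers of `k(x)/x` -/

theorem ConvexOn.add_mul_sub_le_of_hasDerivWithinAt {S : Set ℝ} {f : ℝ → ℝ} {f' x y : ℝ}
    (hf : ConvexOn ℝ S f) (hx : x ∈ S) (hy : y ∈ S) (hf' : HasDerivWithinAt f f' S x) :
    f x + f' * (y - x) ≤ f y := by
  rcases lt_trichotomy x y with h | rfl | h
  · have := hf.le_slope_of_hasDerivWithinAt hx hy h hf'
    rw [slope_def_field, le_div_iff₀ (sub_pos.2 h)] at this
    linarith
  · simp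
  · have := hf.slope_le_of_hasDerivWithinAt hy hx h hf'
    rw [slope_def_field, div_le_iff₀ (sub_pos.2 h)] at this
    linarith

namespace ArmsModel

section Calculus

variable {ν : ℕ → ℝ≥0}

/-- The formal derivative of `genReal`. -/
noncomputable def genDeriv (ν : ℕ → ℝ≥0) (x : ℝ) : ℝ := ∑' j, (ν j : ℝ) * (j * x ^ (j - 1))

/-- Dominated convergence for difference quotients, the `j`-th being at most `j R ^ (j-1)`. This
covers the one-sided derivative at `r = R`, possibly on the circle of convergence. -/
theorem hasDerivWithinAt_genReal {R r : ℝ} (hr : r ∈ Icc 0 R)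
    (hs : Summable fun j => (ν j : ℝ) * R ^ j)
    (hs' : Summable fun j => (ν j : ℝ) * (j * R ^ (j - 1))) :
    HasDerivWithinAt (genReal ν) (genDeriv ν r) (Icc 0 R) r := by
  rw [hasDerivWithinAt_iff_tendsto_slope]
  have hslope : ∀ x ∈ Icc 0 R \ {r}, ∑' j, (ν j : ℝ) *
      ∑ i ∈ Finset.range j, x ^ i * r ^ (j - 1 - i) = slope (genReal ν) r x := by
    intro x hx
    have hne : x - r ≠ 0 := sub_ne_zero.2 hx.2
    rw [slope_def_field, genReal, genReal,
      ← (summable_mul_pow_of_le hx.1.1 hx.1.2 hs).tsum_sub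
        (summable_mul_pow_of_le hr.1 hr.2 hs), ← tsum_div_const]
    refine tsum_congr fun j => ?_
    rw [eq_div_iff hne, mul_assoc, geom_sum₂_mul]
    ring
  refine Tendsto.congr' (f₁ := fun x => ∑' j, (ν j : ℝ) *
    ∑ i ∈ Finset.range j, x ^ i * r ^ (j - 1 - i)) ?_ ?_
  · filter_upwards [self_mem_nhdsWithin] with x hx using hslope x hx
  · refine tendsto_tsum_of_dominated_convergence hs' (fun j => ?_) ?_
    · have hc : Continuous fun x : ℝ => (ν j : ℝ) *
          ∑ i ∈ Finset.range j, x ^ i * r ^ (j - 1 - i) := by fun_prop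
      have h := (hc.tendsto r).mono_left (nhdsWithin_le_nhds (s := Icc 0 R \ {r}))
      convert h using 2
      congr 1
      rw [Finset.sum_congr rfl fun i hi => ?_, Finset.sum_const, Finset.card_range, nsmul_eq_mul]
      rw [← pow_add]
      congr 1
      have := Finset.mem_range.1 hi
      omega
    · filter_upwards [self_mem_nhdsWithin] with x hx j
      have hx0 := hx.1.1
      have hr0 := hr.1
      have hxR := hx.1.2
      have hrR := hr.2
      have hR := hr0.trans hrR
      rw [Real.norm_of_nonneg (by positivity)]
      gcongr
      calc ∑ i ∈ Finset.range j, x ^ i * r ^ (j - 1 - i)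
          ≤ ∑ i ∈ Finset.range j, R ^ i * R ^ (j - 1 - i) := by gcongr
        _ = j * R ^ (j - 1) := by
          rw [Finset.sum_congr rfl fun i hi => ?_, Finset.sum_const, Finset.card_range,
            nsmul_eq_mul]
          rw [← pow_add]
          congr 1
          have := Finset.mem_range.1 hi
          omega

theorem convexOn_genReal {y : ℝ} (hs : Summable fun j => (ν j : ℝ) * y ^ j) :
    ConvexOn ℝ (Icc 0 y) (genReal ν) := by
  refine ⟨convex_Icc 0 y, fun u hu v hv a b ha hb hab => ?_⟩
  have hw := convex_Icc 0 y hu hv ha hb hab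
  have su := (summable_mul_pow_of_le hu.1 hu.2 hs).mul_left a
  have sv := (summable_mul_pow_of_le hv.1 hv.2 hs).mul_left b
  simp only [smul_eq_mul] at hw ⊢
  rw [genReal, genReal, genReal, ← tsum_mul_left, ← tsum_mul_left, ← su.tsum_add sv]
  refine (summable_mul_pow_of_le hw.1 hw.2 hs).tsum_le_tsum (fun j => ?_) (su.add sv)
  have h := (convexOn_pow (𝕜 := ℝ) j).2 hu.1 hv.1 ha hb hab
  simp only [smul_eq_mul] at h
  calc _ ≤ (ν j : ℝ) * (a * u ^ j + b * v ^ j) := by gcongr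
    _ = _ := by ring

theorem strictConvexOn_genReal {y : ℝ} (hs : Summable fun j => (ν j : ℝ) * y ^ j) {J : ℕ}
    (hJ : 2 ≤ J) (hνJ : 0 < ν J) : StrictConvexOn ℝ (Icc 0 y) (genReal ν) := by
  refine ⟨convex_Icc 0 y, fun u hu v hv huv a b ha hb hab => ?_⟩
  have hw := convex_Icc 0 y hu hv ha.le hb.le hab
  have su := (summable_mul_pow_of_le hu.1 hu.2 hs).mul_left a
  have sv := (summable_mul_pow_of_le hv.1 hv.2 hs).mul_left b
  simp only [smul_eq_mul] at hw ⊢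
  rw [genReal, genReal, genReal, ← tsum_mul_left, ← tsum_mul_left, ← su.tsum_add sv]
  refine Summable.tsum_lt_tsum (i := J) (fun j => ?_) ?_
    (summable_mul_pow_of_le hw.1 hw.2 hs) (su.add sv)
  · have h := (convexOn_pow (𝕜 := ℝ) j).2 hu.1 hv.1 ha.le hb.le hab
    simp only [smul_eq_mul] at h
    calc _ ≤ (ν j : ℝ) * (a * u ^ j + b * v ^ j) := by gcongr
      _ = _ := by ring
  · have h := (strictConvexOn_pow hJ).2 hu.1 hv.1 huv ha hb hab
    simp only [smul_eq_mul] at h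
    have hνJ' : (0 : ℝ) < ν J := hνJ
    calc _ < (ν J : ℝ) * (a * u ^ J + b * v ^ J) := by gcongr
      _ = _ := by ring

/-- `r ∈ (0, 1]` minimises `k x / x` on `(0, 1]`. -/
structure IsRatioMin (ν : ℕ → ℝ≥0) (r : ℝ) : Prop where
  mem : r ∈ Ioc (0 : ℝ) 1
  summable : Summable fun j => (ν j : ℝ) * r ^ j
  le : ∀ x ∈ Icc (0 : ℝ) 1, (Summable fun j => (ν j : ℝ) * x ^ j) →
    genReal ν r * x ≤ r * genReal ν x

/-- The chord between two minimisers lies on a line through the origin; by strict convexity `k` is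
below it at the midpoint, where the ratio would be smaller. -/
theorem IsRatioMin.eq {r r' : ℝ} (h : IsRatioMin ν r) (h' : IsRatioMin ν r') {J : ℕ}
    (hJ : 2 ≤ J) (hνJ : 0 < ν J) : r = r' := by
  wlog hlt : r < r' generalizing r r'
  · rcases (not_lt.1 hlt).eq_or_lt with e | hlt'
    · exact e.symm
    · exact (this h' h hlt').symm
  exfalso
  have e : genReal ν r * r' = r * genReal ν r' := by
    refine le_antisymm (h.le r' ⟨h'.mem.1.le, h'.mem.2⟩ h'.summable) ?_
    have := h'.le r ⟨h.mem.1.le, h.mem.2⟩ h.summable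
    linarith
  have hsc := strictConvexOn_genReal h'.summable hJ hνJ
  have hm := hsc.2 (show r ∈ Icc 0 r' from ⟨h.mem.1.le, hlt.le⟩)
    (show r' ∈ Icc 0 r' from ⟨h'.mem.1.le, le_rfl⟩) hlt.ne
    (show (0 : ℝ) < 1 / 2 by norm_num) (show (0 : ℝ) < 1 / 2 by norm_num) (by norm_num)
  simp only [smul_eq_mul] at hm
  have hr := h.mem.1
  have hm' := h.le (1 / 2 * r + 1 / 2 * r') ⟨by linarith, by linarith [h'.mem.2]⟩
    (summable_mul_pow_of_le (by linarith) (by linarith) h'.summable)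
  have hm2 := mul_lt_mul_of_pos_left hm hr
  linarith

theorem IsRatioMin.eq_div {r : ℝ} (h : IsRatioMin ν r) (hpos : ∀ x ∈ Ioc (0 : ℝ) 1,
      (Summable fun j => (ν j : ℝ) * x ^ j) → 0 < genReal ν x) {B : ℝ}
    (hB : ∀ x ∈ Icc (0 : ℝ) 1, (Summable fun j => (ν j : ℝ) * x ^ j) → x ≤ B * genReal ν x)
    (hB' : ∀ b < B, ∃ x ∈ Ioc (0 : ℝ) 1, (Summable fun j => (ν j : ℝ) * x ^ j) ∧
      b * genReal ν x ≤ x) : B = r / genReal ν r := by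
  have hk := hpos r h.mem h.summable
  refine le_antisymm (le_of_forall_lt fun b hb => ?_) ?_
  · obtain ⟨b', hbb', hb'⟩ := exists_between hb
    obtain ⟨x, hx, hs, hle⟩ := hB' b' hb'
    refine hbb'.trans_le ?_
    rw [le_div_iff₀ hk]
    have h1 := h.le x ⟨hx.1.le, hx.2⟩ hs
    have hkx := hpos x hx hs
    refine le_of_mul_le_mul_right ?_ hkx
    calc b' * genReal ν r * genReal ν x = genReal ν r * (b' * genReal ν x) := by ring
      _ ≤ genReal ν r * x := by gcongr
      _ ≤ _ := h1
  · rw [div_le_iff₀ hk]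
    exact hB r ⟨h.mem.1.le, h.mem.2⟩ h.summable

theorem le_genReal {x : ℝ} (hx : 0 ≤ x) (hs : Summable fun j => (ν j : ℝ) * x ^ j) :
    (ν 0 : ℝ) ≤ genReal ν x := by
  simpa [genReal] using hs.le_tsum 0 fun j _ => by positivity

/-- The tangent at `r` passes through the origin and supports the convex graph. -/
theorem IsTangencyPoint.isRatioMin {r : ℝ} (h : IsTangencyPoint (genReal ν) r) (hν0 : 0 < ν 0)
    (hs : ∀ x ∈ Ico (0 : ℝ) 1, Summable fun j => (ν j : ℝ) * x ^ j) : IsRatioMin ν r := by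
  obtain ⟨hr, hd, he⟩ := h
  have hν0' : (0 : ℝ) < ν 0 := hν0
  have hsr : Summable fun j => (ν j : ℝ) * r ^ j := by
    rcases hr.2.lt_or_eq with hlt | rfl
    · exact hs r ⟨hr.1.le, hlt⟩
    · by_contra hns
      -- A divergent `tsum` takes the value `0`. Left continuity at `1` would then contradict `k ≥ ν
      -- 0 > 0`, so this default creates no spurious tangency point.
      have h1 : genReal ν 1 = 0 := tsum_eq_zero_of_not_summable hns
      have hcont : Tendsto (genReal ν) (𝓝[Ico 0 1] 1) (𝓝 0) := by
        have := hd.continuousWithinAt.mono Ico_subset_Icc_self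
        rwa [ContinuousWithinAt, h1] at this
      have hne : (𝓝[Ico (0 : ℝ) 1] 1).NeBot := by
        rw [← mem_closure_iff_nhdsWithin_neBot, closure_Ico zero_ne_one]
        exact ⟨zero_le_one, le_rfl⟩
      have := ge_of_tendsto hcont (b := (ν 0 : ℝ)) (by
        filter_upwards [self_mem_nhdsWithin] with x hx using le_genReal hx.1 (hs x hx))
      linarith
  refine ⟨hr, hsr, fun x hx hsx => ?_⟩
  -- Convexity is used only on `[0, max r x]`, since the series may diverge at `1`.
  have hsy : Summable fun j => (ν j : ℝ) * max r x ^ j := by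
    rcases max_cases r x with ⟨e, -⟩ | ⟨e, -⟩ <;> rwa [e]
  have hd' := (hd.hasDerivWithinAt).mono (Icc_subset_Icc_right (max_le hr.2 hx.2) :
    Icc 0 (max r x) ⊆ Icc 0 1)
  have := (convexOn_genReal hsy).add_mul_sub_le_of_hasDerivWithinAt
    ⟨hr.1.le, le_max_left _ _⟩ ⟨hx.1, le_max_right _ _⟩ hd'
  rw [he] at this
  have hr0 := hr.1
  have e : genReal ν r * x = r * (genReal ν r + genReal ν r / r * (x - r)) := by
    field_simp
    ring
  rw [e]
  gcongr

theorem isTangencyPoint_one (hs : Summable fun j => (ν j : ℝ))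
    (hs' : Summable fun j => (ν j : ℝ) * j) (h : ∑' j, (ν j : ℝ) * j = ∑' j, (ν j : ℝ)) :
    IsTangencyPoint (genReal ν) 1 := by
  have hd := hasDerivWithinAt_genReal (ν := ν) (R := 1) (r := 1) ⟨zero_le_one, le_rfl⟩
    (by simpa using hs) (by simpa using hs')
  refine ⟨⟨one_pos, le_rfl⟩, hd.differentiableWithinAt, ?_⟩
  rw [hd.derivWithin (uniqueDiffOn_Icc one_pos 1 ⟨zero_le_one, le_rfl⟩)]
  simpa [genDeriv, genReal] using h

/-- Tangency means that `x k'(x) - k(x) = ∑ (j-1) ν j x ^ j` vanishes. This function is `-ν 0 < 0`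
at `0` and positive somewhere below `1`, because a finite partial sum is positive at `1` and the
remaining terms are nonnegative. -/
theorem exists_isTangencyPoint_lt_one (hν0 : 0 < ν 0)
    (hs : ∀ x ∈ Ico (0 : ℝ) 1, Summable fun j => (ν j : ℝ) * x ^ j)
    (hs' : ∀ x ∈ Ico (0 : ℝ) 1, Summable fun j => (ν j : ℝ) * (j * x ^ (j - 1)))
    {N : ℕ} (hN : 0 < ∑ j ∈ Finset.range N, ((j : ℝ) - 1) * ν j) :
    ∃ r < 1, IsTangencyPoint (genReal ν) r := by
  have hN0 : N ≠ 0 := by rintro rfl; simp at hN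
  have hp : Continuous fun x : ℝ => ∑ j ∈ Finset.range N, ((j : ℝ) - 1) * ν j * x ^ j := by
    fun_prop
  obtain ⟨y, hy0, hy1, hy⟩ : ∃ y : ℝ, 0 < y ∧ y < 1 ∧
      0 < ∑ j ∈ Finset.range N, ((j : ℝ) - 1) * ν j * y ^ j := by
    have h1 : ∀ᶠ x in 𝓝[<] (1 : ℝ), 0 < ∑ j ∈ Finset.range N, ((j : ℝ) - 1) * ν j * x ^ j :=
      (hp.continuousAt.tendsto.mono_left nhdsWithin_le_nhds).eventually_const_lt (by simpa using hN)
    obtain ⟨y, h, hy⟩ := (h1.and (Ioo_mem_nhdsLT zero_lt_one)).exists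
    exact ⟨y, hy.1, hy.2, h⟩
  have hsplit : ∀ x : ℝ, ∀ j : ℕ, ((j : ℝ) - 1) * ν j * x ^ j =
      x * ((ν j : ℝ) * (j * x ^ (j - 1))) - (ν j : ℝ) * x ^ j := by
    intro x j
    cases j with
    | zero => simp
    | succ j =>
      rw [Nat.add_sub_cancel]
      ring
  have hsφ : ∀ x ∈ Ico (0 : ℝ) 1, Summable fun j : ℕ => ((j : ℝ) - 1) * ν j * x ^ j :=
    fun x hx => (((hs' x hx).mul_left x).sub (hs x hx)).congr fun j => (hsplit x j).symm
  have hcont : ContinuousOn (fun x : ℝ => ∑' j : ℕ, ((j : ℝ) - 1) * ν j * x ^ j) (Icc 0 y) := by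
    refine continuousOn_tsum (fun j => by fun_prop)
      (((hs' y ⟨hy0.le, hy1⟩).mul_left y).add (hs y ⟨hy0.le, hy1⟩)) fun j x hx => ?_
    have hx0 := hx.1
    have hxy := hx.2
    rw [hsplit]
    refine (norm_sub_le _ _).trans ?_
    rw [Real.norm_of_nonneg (by positivity), Real.norm_of_nonneg (by positivity)]
    gcongr
  have hneg : (fun x : ℝ => ∑' j : ℕ, ((j : ℝ) - 1) * ν j * x ^ j) 0 < 0 := by
    have : (0 : ℝ) < ν 0 := hν0
    simp only
    rw [tsum_eq_single 0 fun j hj => by rw [zero_pow hj, mul_zero]]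
    simpa using this
  have hpos : 0 < (fun x : ℝ => ∑' j : ℕ, ((j : ℝ) - 1) * ν j * x ^ j) y := by
    refine hy.trans_le ((hsφ y ⟨hy0.le, hy1⟩).sum_le_tsum _ fun j hj => ?_)
    have : (1 : ℝ) ≤ j := by
      rw [Finset.mem_range, not_lt] at hj
      exact_mod_cast (Nat.one_le_iff_ne_zero.2 hN0).trans hj
    have := sub_nonneg.2 this
    positivity
  obtain ⟨r, hr, hr0⟩ := intermediate_value_Icc hy0.le hcont ⟨hneg.le, hpos.le⟩
  have hrne : r ≠ 0 := by
    rintro rfl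
    exact hneg.ne hr0
  have hrpos : 0 < r := lt_of_le_of_ne hr.1 (Ne.symm hrne)
  have hr1 : r < 1 := hr.2.trans_lt hy1
  have hrI : r ∈ Ico (0 : ℝ) 1 := ⟨hr.1, hr1⟩
  obtain ⟨R, hrR, hR1⟩ := exists_between hr1
  have hRI : R ∈ Ico (0 : ℝ) 1 := ⟨hr.1.trans hrR.le, hR1⟩
  have hd := (hasDerivWithinAt_genReal ⟨hr.1, hrR.le⟩ (hs R hRI) (hs' R hRI)).mono_of_mem_nhdsWithin
    (t := Icc 0 R) (s := Icc 0 1) (by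
      filter_upwards [self_mem_nhdsWithin, mem_nhdsWithin_of_mem_nhds (Iic_mem_nhds hrR)]
        with x hx hxR using ⟨hx.1, hxR⟩)
  refine ⟨r, hr1, ⟨hrpos, hr1.le⟩, hd.differentiableWithinAt, ?_⟩
  rw [hd.derivWithin (uniqueDiffOn_Icc one_pos r ⟨hr.1, hr1.le⟩), eq_div_iff hrne]
  simp only [hsplit] at hr0
  rw [((hs' r hrI).mul_left r).tsum_sub (hs r hrI), tsum_mul_left] at hr0
  rw [genDeriv, genReal]
  linarith

/-- Summing Bernoulli's inequality `x ^ j ≥ 1 + j (x - 1)` gives `k(x) ≥ A + K (x - 1) ≥ A x` when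
`K ≤ A` and `x ≤ 1`. -/
theorem isRatioMin_one (hs : Summable fun j => (ν j : ℝ))
    (hs' : Summable fun j => (ν j : ℝ) * j) (h : ∑' j, (ν j : ℝ) * j ≤ ∑' j, (ν j : ℝ)) :
    IsRatioMin ν 1 := by
  refine ⟨⟨one_pos, le_rfl⟩, by simpa using hs, fun x hx hsx => ?_⟩
  have h1 : genReal ν 1 = ∑' j, (ν j : ℝ) := by simp [genReal]
  rw [h1, one_mul]
  have hle : ∑' j, ((ν j : ℝ) + (ν j : ℝ) * j * (x - 1)) ≤ genReal ν x := by
    refine (hs.add (hs'.mul_right _)).tsum_le_tsum (fun j => ?_) hsx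
    have := mul_le_mul_of_nonneg_left (one_add_mul_sub_le_pow (a := x) (by linarith [hx.1]) j)
      (ν j).coe_nonneg
    linarith
  rw [hs.tsum_add (hs'.mul_right _), tsum_mul_right] at hle
  have := mul_le_mul_of_nonneg_right h (sub_nonneg.2 hx.2)
  linarith

end Calculus

end ArmsModel

/-! ### Initial moments and the gelation criterion -/

namespace ArmsModel

theorem moment_of_monodisperse {c : ℕ → ℕ → ℝ} (h0 : ∀ a m, 2 ≤ m → c a m = 0) {f : ℕ → ℝ}
    (hf : f 0 = 0) : moment c f = ∑' j, ENNReal.ofReal (f (j + 1) * c (j + 1) 1) := by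
  rw [moment, ENNReal.tsum_prod', tsum_eq_zero_add' ENNReal.summable]
  simp only [hf, zero_mul, ENNReal.ofReal_zero, tsum_zero, zero_add]
  refine tsum_congr fun a => ?_
  rw [tsum_eq_single 0 fun n hn => by rw [h0 _ _ (by omega)]; simp]

theorem armsGen_of_monodisperse {c : ℕ → ℕ → ℝ} (h0 : ∀ a m, 2 ≤ m → c a m = 0) {ν : ℕ → ℝ≥0}
    (hν : ∀ j, (ν j : ℝ) = ((j : ℝ) + 1) * c (j + 1) 1) :
    (fun x => armsGen c x 1) = genReal ν := by
  funext x
  have hinj : Function.Injective fun j : ℕ => (j, 0) := fun i j h => (Prod.mk.inj h).1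
  rw [armsGen, genReal, ← hinj.tsum_eq]
  · exact tsum_congr fun j => by simp [hν]
  · rintro ⟨a, n⟩ hp
    cases n with
    | zero => exact ⟨a, rfl⟩
    | succ n => exact absurd (by simp [h0 (a + 1) (n + 1 + 1) (by omega)]) hp

section Gelation

variable {ν : ℕ → ℝ≥0}

theorem summable_of_tsum_ofReal_ne_top {f : ℕ → ℝ} (hf : ∀ j, 0 ≤ f j)
    (h : ∑' j, ENNReal.ofReal (f j) ≠ ∞) : Summable f := by
  simpa [ENNReal.toReal_ofReal (hf _)] using ENNReal.summable_toReal h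

theorem summable_of_summable_mul_nat (h : Summable fun j => (ν j : ℝ) * j) :
    Summable fun j => (ν j : ℝ) := by
  rw [← summable_nat_add_iff 1] at h ⊢
  refine h.of_nonneg_of_le (fun j => by positivity) fun j => ?_
  push_cast
  nlinarith [(ν (j + 1)).coe_nonneg, (Nat.cast_nonneg j : (0 : ℝ) ≤ j)]

/-- Only `j = 0` contributes negatively, so bounded partial sums already force `A` and `K` to be
finite. It turns the failure of the interior tangency criterion into `K ≤ A < ∞`. -/
theorem summable_of_forall_sum_nonpos
    (h : ∀ N, ∑ j ∈ Finset.range N, ((j : ℝ) - 1) * ν j ≤ 0) :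
    (Summable fun j => (ν j : ℝ) * j) ∧ ∑' j, (ν j : ℝ) * j ≤ ∑' j, (ν j : ℝ) := by
  have hν : Summable fun j => (ν j : ℝ) := by
    -- `ν j ≤ (j-1) ν j` holds for `j ≥ 2`; the constant repairs `j = 0` and `j = 1`.
    refine summable_of_sum_range_le (c := 2 * ν 0 + ν 1) (fun j => by positivity) fun N => ?_
    have hterm : ∀ j : ℕ, (ν j : ℝ) ≤ ((j : ℝ) - 1) * ν j + (if j = 0 then 2 * (ν 0 : ℝ) else 0) +
        (if j = 1 then (ν 1 : ℝ) else 0) := by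
      rintro (_ | _ | j)
      · simp; linarith
      · simp
      · simp only [Nat.add_eq_zero_iff, one_ne_zero, and_false, if_false, Nat.add_eq_right]
        push_cast
        nlinarith [(ν (j + 1 + 1)).coe_nonneg, (Nat.cast_nonneg j : (0 : ℝ) ≤ j)]
    refine (Finset.sum_le_sum fun j _ => hterm j).trans ?_
    rw [Finset.sum_add_distrib, Finset.sum_add_distrib, Finset.sum_ite_eq', Finset.sum_ite_eq']
    have h1 : (if 0 ∈ Finset.range N then 2 * (ν 0 : ℝ) else 0) ≤ 2 * ν 0 := by
      split_ifs
      · exact le_rfl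
      · positivity
    have h2 : (if 1 ∈ Finset.range N then (ν 1 : ℝ) else 0) ≤ ν 1 := by
      split_ifs
      · exact le_rfl
      · positivity
    linarith [h N]
  have hle : ∀ N, ∑ j ∈ Finset.range N, (ν j : ℝ) * j ≤ ∑' j, (ν j : ℝ) := fun N => by
    have h1 : ∑ j ∈ Finset.range N, (ν j : ℝ) * j =
        ∑ j ∈ Finset.range N, ((j : ℝ) - 1) * ν j + ∑ j ∈ Finset.range N, (ν j : ℝ) := by
      rw [← Finset.sum_add_distrib]
      exact Finset.sum_congr rfl fun j _ => by ring
    have h2 := hν.sum_le_tsum (Finset.range N) fun j _ => (ν j).coe_nonneg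
    linarith [h N]
  exact ⟨summable_of_sum_range_le (fun j => by positivity) hle,
    Real.tsum_le_of_sum_range_le (fun j => by positivity) hle⟩

/-- Otherwise `K = ν 1 < ν 0 + ν 1 = A`. The index found makes `k` strictly convex. -/
theorem exists_two_le_pos (hν0 : 0 < ν 0)
    (h : ∑' j, ENNReal.ofReal (ν j) ≤ ∑' j, ENNReal.ofReal ((ν j : ℝ) * j)) :
    ∃ J, 2 ≤ J ∧ 0 < ν J := by
  by_contra! hcon
  have hz : ∀ j, 2 ≤ j → ν j = 0 := fun j hj => le_antisymm (hcon j hj) zero_le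
  rw [tsum_eq_single (f := fun j : ℕ => ENNReal.ofReal ((ν j : ℝ) * j)) 1 fun j hj => ?_] at h
  · have h2 := (ENNReal.sum_le_tsum (f := fun j => ENNReal.ofReal (ν j)) (Finset.range 2)).trans h
    simp only [Finset.sum_range_succ, Finset.sum_range_zero, zero_add, ENNReal.ofReal_coe_nnreal,
      Nat.cast_one, mul_one] at h2
    have h3 : ν 0 + ν 1 ≤ ν 1 := by exact_mod_cast h2
    exact absurd h3 (not_le.2 (lt_add_of_pos_left _ hν0))
  · rcases Nat.eq_zero_or_pos j with rfl | hj'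
    · simp
    · rw [hz j (by omega)]
      simp

theorem summable_genReal_of_le {M : ℝ} (hM : ∀ j : ℕ, (ν j : ℝ) ≤ ((j : ℝ) + 1) * M) {x : ℝ}
    (hx : x ∈ Ico (0 : ℝ) 1) :
    (Summable fun j => (ν j : ℝ) * x ^ j) ∧ Summable fun j => (ν j : ℝ) * (j * x ^ (j - 1)) := by
  have hx0 := hx.1
  have hn : ‖x‖ < 1 := by rw [Real.norm_of_nonneg hx0]; exact hx.2
  have s0 := summable_pow_mul_geometric_of_norm_lt_one (R := ℝ) 0 hn
  have s1 := summable_pow_mul_geometric_of_norm_lt_one (R := ℝ) 1 hn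
  have s2 := summable_pow_mul_geometric_of_norm_lt_one (R := ℝ) 2 hn
  constructor
  · refine ((s1.add s0).mul_left M).of_nonneg_of_le (fun j => by positivity) fun j => ?_
    calc (ν j : ℝ) * x ^ j ≤ (((j : ℝ) + 1) * M) * x ^ j := by gcongr; exact hM j
      _ = _ := by ring
  · rw [← summable_nat_add_iff 1]
    refine (((s2.add (s1.mul_left 3)).add (s0.mul_left 2)).mul_left M).of_nonneg_of_le
      (fun j => by positivity) fun j => ?_
    calc (ν (j + 1) : ℝ) * ((j + 1 : ℕ) * x ^ (j + 1 - 1))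
        ≤ ((((j + 1 : ℕ) : ℝ) + 1) * M) * ((j + 1 : ℕ) * x ^ (j + 1 - 1)) := by
          gcongr
          exact hM (j + 1)
      _ = _ := by
          rw [Nat.add_sub_cancel]
          push_cast
          ring

end Gelation

theorem gelTime_eq_top_iff (c : ℕ → ℕ → ℝ) : gelTime c = ∞ ↔
    armsFactorialMoment c ≠ ∞ ∧ armsFactorialMoment c ≤ arms c := by
  rw [gelTime]
  split_ifs with h1 h2
  · simp [h1]
  · have : armsFactorialMoment c - arms c ≠ 0 := (tsub_pos_of_lt h2).ne'
    simp [this, h2]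
  · simp [h1, not_lt.1 h2]

end ArmsModel

/-! ### Assembly of the four assertions -/

theorem mainTheorem6
    (μ : ℕ → ℝ) (hμ_nonneg : ∀ a, 0 ≤ μ a) (hμ_sum : Summable μ) (hμ_one : 0 < μ 1)
    (c : ℝ → ℕ → ℕ → ℝ) (hc : IsSolution c)
    (hc_zero : ∀ a m : ℕ, 1 ≤ m → c 0 a m = if m = 1 then μ a else 0) :
    (∀ t : ℝ, 0 ≤ t → ∀ a m : ℕ, 2 ≤ m →
      c t a m = ((a + m - 2)! : ℝ) / ((a ! : ℝ) * (m ! : ℝ)) *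
        (beta c t ^ (m - 1) / alpha c t ^ a) * convPow (shifted μ) m (a + m - 2)) ∧
    (∀ a m : ℕ, 1 ≤ a → 1 ≤ m → Tendsto (fun t => c t a m) atTop (𝓝 0)) ∧
    ∃ βinf : ℝ, 0 < βinf ∧ Tendsto (beta c) atTop (𝓝 βinf) ∧
      (∀ m : ℕ, 2 ≤ m → Tendsto (fun t => c t 0 m) atTop
        (𝓝 (1 / ((m : ℝ) * ((m : ℝ) - 1)) * βinf ^ (m - 1) *
          convPow (shifted μ) m (m - 2)))) ∧
      (arms (c 0) ≤ armsFactorialMoment (c 0) →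
        ∃ r : ℝ, IsTangencyPoint (fun x => armsGen (c 0) x 1) r ∧
          (∀ r' : ℝ, IsTangencyPoint (fun x => armsGen (c 0) x 1) r' → r' = r) ∧
          βinf = 1 / derivWithin (fun x => armsGen (c 0) x 1) (Icc 0 1) r ∧
          βinf = r / armsGen (c 0) r 1) ∧
      (gelTime (c 0) = ∞ → ENNReal.ofReal βinf = (arms (c 0))⁻¹) ∧
      (gelTime (c 0) < ∞ → (arms (c 0))⁻¹ < ENNReal.ofReal βinf) := by
  have h0 : ∀ a m, 2 ≤ m → c 0 a m = 0 := fun a m hm => by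
    rw [hc_zero a m (by omega), if_neg (by omega)]
  have hc1 : ∀ a, c 0 a 1 = μ a := fun a => by simp [hc_zero]
  have h11 : 0 < c 0 1 1 := by rwa [hc1]
  obtain ⟨ν, hνs⟩ : ∃ ν : ℕ → ℝ≥0, shifted μ = fun j => (ν j : ℝ) :=
    ⟨fun j => ⟨shifted μ j, mul_nonneg (by positivity) (hμ_nonneg _)⟩, rfl⟩
  have hνμ : ∀ j : ℕ, (ν j : ℝ) = ((j : ℝ) + 1) * μ (j + 1) := fun j => (congrFun hνs j).symm
  have hν : ∀ j : ℕ, (ν j : ℝ) = ((j : ℝ) + 1) * c 0 (j + 1) 1 := fun j => by rw [hc1, hνμ]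
  have hν0 : 0 < ν 0 := by
    rw [← NNReal.coe_pos, hνμ]
    simpa using hμ_one
  have hrad : ∀ x ∈ Ico (0 : ℝ) 1, (Summable fun j => (ν j : ℝ) * x ^ j) ∧
      Summable fun j => (ν j : ℝ) * (j * x ^ (j - 1)) := fun x hx => by
    refine summable_genReal_of_le (M := ∑' a, μ a) (fun j => ?_) hx
    rw [hνμ]
    gcongr
    exact hμ_sum.le_tsum _ fun a _ => hμ_nonneg a
  have hk := armsGen_of_monodisperse h0 hν
  have hk1 : ∀ x, armsGen (c 0) x 1 = genReal ν x := congrFun hk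
  have hA : arms (c 0) = ∑' j, ENNReal.ofReal (ν j) := by
    rw [arms, moment_of_monodisperse h0 (by simp)]
    exact tsum_congr fun j => by rw [hν]; push_cast; rfl
  have hK : armsFactorialMoment (c 0) = ∑' j, ENNReal.ofReal ((ν j : ℝ) * j) := by
    rw [armsFactorialMoment, moment_of_monodisperse h0 (by simp)]
    refine tsum_congr fun j => ?_
    rw [hν]
    congr 1
    push_cast
    ring
  have hexp : ∀ t, 0 ≤ t → ∀ a n : ℕ, c t a (n + 2) = ((a + n)! / (a ! * (n + 2)!) *
      convPow (shifted μ) (n + 2) (a + n)) * (beta c t ^ (n + 1) * (alpha c t)⁻¹ ^ a) := by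
    intro t ht a n
    rw [inv_pow, hνs, ← mul_assoc, ← hc.explicit h0 hν n ht a,
      mul_inv_cancel_right₀ (pow_pos (alpha_pos c t) a).ne']
  obtain ⟨B, hB0, hB, -⟩ := hc.exists_tendsto_beta h11
  obtain ⟨hBl, hBu⟩ := hc.limit_beta h0 hν h11 hB
  have hz := hc.tendsto_inv_alpha h11
  have hpos : ∀ x ∈ Ioc (0 : ℝ) 1, (Summable fun j => (ν j : ℝ) * x ^ j) → 0 < genReal ν x :=
    fun x hx hs => lt_of_lt_of_le (NNReal.coe_pos.2 hν0) (le_genReal hx.1.le hs)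
  refine ⟨?_, ?_, B, hB0, hB, ?_, ?_, ?_, ?_⟩
  · intro t ht a m hm
    obtain ⟨n, rfl⟩ := Nat.exists_eq_add_of_le' hm
    rw [hexp t ht, show a + (n + 2) - 2 = a + n by omega, show n + 2 - 1 = n + 1 by omega]
    rw [inv_pow]
    ring
  · intro a m ha hm
    have hza : Tendsto (fun t => (alpha c t)⁻¹ ^ a) atTop (𝓝 0) := by
      simpa [zero_pow (show a ≠ 0 by omega)] using hz.pow a
    rcases hm.eq_or_lt with rfl | hm
    · have h := hza.const_mul (μ a)
      rw [mul_zero] at h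
      refine h.congr' ?_
      filter_upwards [eventually_gt_atTop 0] with t ht
      have h1 := hc.mul_alpha_pow ht (a := a) (m := 1) le_rfl
      have h2 : c t a 1 * alpha c t ^ a = μ a := by rw [h1, hc1]; simp [gain]
      rw [← h2, inv_pow, mul_inv_cancel_right₀ (pow_pos (alpha_pos c t) a).ne']
    · obtain ⟨n, rfl⟩ := Nat.exists_eq_add_of_le' (show 2 ≤ m from hm)
      have h := ((hB.pow (n + 1)).mul hza).const_mul ((a + n)! / (a ! * (n + 2)!) *
        convPow (shifted μ) (n + 2) (a + n))
      rw [mul_zero, mul_zero] at h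
      refine h.congr' ?_
      filter_upwards [eventually_ge_atTop 0] with t ht using (hexp t ht a n).symm
  · intro m hm
    obtain ⟨n, rfl⟩ := Nat.exists_eq_add_of_le' hm
    have h := (hB.pow (n + 1)).const_mul ((0 + n)! / (0 ! * (n + 2)!) *
        convPow (shifted μ) (n + 2) (0 + n))
    have e : (((0 + n)! : ℕ) : ℝ) / ((0 ! : ℕ) * ((n + 2)! : ℕ)) =
        1 / (((n + 2 : ℕ) : ℝ) * (((n + 2 : ℕ) : ℝ) - 1)) := by
      rw [zero_add, Nat.factorial_succ, Nat.factorial_succ, Nat.factorial_zero]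
      have : (n ! : ℝ) ≠ 0 := by positivity
      have : (n : ℝ) + 1 ≠ 0 := by positivity
      have : (n : ℝ) + 2 ≠ 0 := by positivity
      have : (n : ℝ) + 2 - 1 ≠ 0 := by rw [show (n : ℝ) + 2 - 1 = n + 1 by ring]; positivity
      push_cast
      field_simp
      ring
    rw [e, mul_right_comm, zero_add] at h
    refine h.congr' ?_
    filter_upwards [eventually_ge_atTop 0] with t ht
    rw [hexp t ht, e, pow_zero, mul_one, zero_add]
  · intro hAK
    simp only [hk1]
    rw [hA, hK] at hAK
    obtain ⟨J, hJ, hνJ⟩ := exists_two_le_pos hν0 hAK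
    obtain ⟨r, hr⟩ : ∃ r, IsTangencyPoint (genReal ν) r := by
      -- Either the tangency point is interior, or `K ≤ A < ∞`; in the second case `K = A` and the
      -- point is `1`.
      by_cases hN : ∃ N, 0 < ∑ j ∈ Finset.range N, ((j : ℝ) - 1) * ν j
      · obtain ⟨N, hN⟩ := hN
        obtain ⟨r, -, hr⟩ := exists_isTangencyPoint_lt_one hν0 (fun x hx => (hrad x hx).1)
          (fun x hx => (hrad x hx).2) hN
        exact ⟨r, hr⟩
      · push Not at hN
        obtain ⟨hs', hle⟩ := summable_of_forall_sum_nonpos hN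
        have hs := summable_of_summable_mul_nat hs'
        rw [← ENNReal.ofReal_tsum_of_nonneg (fun j => by positivity) hs',
          ← ENNReal.ofReal_tsum_of_nonneg (fun j => by positivity) hs,
          ENNReal.ofReal_le_ofReal_iff (tsum_nonneg fun j => by positivity)] at hAK
        exact ⟨1, isTangencyPoint_one hs hs' (le_antisymm hle hAK)⟩
    have hmin := fun {r'} (hr' : IsTangencyPoint (genReal ν) r') =>
      hr'.isRatioMin hν0 fun x hx => (hrad x hx).1
    have hBr := (hmin hr).eq_div hpos hBl hBu
    refine ⟨r, hr, fun r' hr' => (hmin hr').eq (hmin hr) hJ hνJ, ?_, hBr⟩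
    change B = 1 / derivWithin (genReal ν) (Icc 0 1) r
    rw [hr.2.2, one_div_div, hBr]
  · intro hgel
    rw [gelTime_eq_top_iff, hA, hK] at hgel
    obtain ⟨hKt, hKA⟩ := hgel
    have hs' := summable_of_tsum_ofReal_ne_top (fun j => by positivity) hKt
    have hs := summable_of_summable_mul_nat hs'
    rw [← ENNReal.ofReal_tsum_of_nonneg (fun j => by positivity) hs',
      ← ENNReal.ofReal_tsum_of_nonneg (fun j => by positivity) hs,
      ENNReal.ofReal_le_ofReal_iff (tsum_nonneg fun j => by positivity)] at hKA
    have hmin := isRatioMin_one hs hs' hKA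
    have hg : genReal ν 1 = ∑' j, (ν j : ℝ) := by simp [genReal]
    have hg0 := hpos 1 hmin.mem hmin.summable
    rw [hmin.eq_div hpos hBl hBu, hA, ← ENNReal.ofReal_tsum_of_nonneg (fun j => by positivity) hs,
      ← hg, one_div, ENNReal.ofReal_inv_of_pos hg0]
  · intro hgel
    have hnot : ¬ (armsFactorialMoment (c 0) ≠ ∞ ∧ armsFactorialMoment (c 0) ≤ arms (c 0)) :=
      fun h => hgel.ne ((gelTime_eq_top_iff _).2 h)
    have hAK : arms (c 0) ≤ armsFactorialMoment (c 0) := by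
      by_contra hlt
      exact hnot ⟨(lt_of_lt_of_le (not_le.1 hlt) le_top).ne, (not_le.1 hlt).le⟩
    rw [hA, hK] at hAK hnot
    obtain ⟨J, hJ, hνJ⟩ := exists_two_le_pos hν0 hAK
    obtain ⟨N, hN⟩ : ∃ N, 0 < ∑ j ∈ Finset.range N, ((j : ℝ) - 1) * ν j := by
      by_contra! hN
      obtain ⟨hs', hle⟩ := summable_of_forall_sum_nonpos hN
      have hs := summable_of_summable_mul_nat hs'
      rw [← ENNReal.ofReal_tsum_of_nonneg (fun j => by positivity) hs',
        ← ENNReal.ofReal_tsum_of_nonneg (fun j => by positivity) hs] at hnot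
      exact hnot ⟨ENNReal.ofReal_ne_top, ENNReal.ofReal_le_ofReal hle⟩
    obtain ⟨r, hr1, hr⟩ := exists_isTangencyPoint_lt_one hν0 (fun x hx => (hrad x hx).1)
      (fun x hx => (hrad x hx).2) hN
    rw [hA]
    by_cases hs : Summable fun j => (ν j : ℝ)
    · have hg : genReal ν 1 = ∑' j, (ν j : ℝ) := by simp [genReal]
      have hs1 : Summable fun j => (ν j : ℝ) * 1 ^ j := by simpa using hs
      have hg0 := hpos 1 ⟨one_pos, le_rfl⟩ hs1
      rw [← ENNReal.ofReal_tsum_of_nonneg (fun j => by positivity) hs, ← hg,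
        ← ENNReal.ofReal_inv_of_pos hg0, ENNReal.ofReal_lt_ofReal_iff hB0]
      -- If `β∞ ≤ 1/A`, then `1` would also minimise `k(x)/x`, against uniqueness of the minimiser
      -- `r < 1`.
      by_contra! hle
      have hmin1 : IsRatioMin ν 1 := by
        refine ⟨⟨one_pos, le_rfl⟩, hs1, fun x hx hsx => ?_⟩
        have h1 := (hBl x hx hsx).trans
          (mul_le_mul_of_nonneg_right hle (genReal_nonneg ν hx.1))
        rw [inv_mul_eq_div, le_div_iff₀ hg0] at h1
        linarith
      exact hr1.ne ((hr.isRatioMin hν0 fun x hx => (hrad x hx).1).eq hmin1 hJ hνJ)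
    · have htop : ∑' j, ENNReal.ofReal (ν j) = ∞ := by
        by_contra hne
        exact hs (summable_of_tsum_ofReal_ne_top (fun j => by positivity) hne)
      rw [htop, ENNReal.inv_top]
      exact ENNReal.ofReal_pos.2 hB0
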